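/- Let $\mathbb{T}$ be a rooted metric tree graph with branching number $K\ge 1$: the root has exactly one adjacent edge, every other vertex has $K+1$ adjacent edges, there are no loops, and each edge $e$ has a length $L_e\in(0,\infty)$ and is parametrized by $l\in[0,L_e]$, with $l$ increasing away from the root; $'$ or $\partial/\partial x$ denotes the derivative in this direction (one-sided at the end points of an edge). Let $\alpha\in[0,\pi)$, and let $-\Delta_{\mathbb{T}}$ act in $L^2(\mathbb{T})=\bigoplus_e L^2[0,L_e]$ as $\psi\mapsto-\psi''$ on the functions $\psi$ with $\psi,\psi''\in L^2(\mathbb{T})$ and $\psi_e\in H^2[0,L_e]$ for all $e$ which are continuous at the vertices and satisfy the Kirchhoff condition $\psi_e'(L_e)=\sum_f\psi_f'(0)$ (sum over the $K$ edges $f$ following $e$) at every vertex other than the root, and $\cos(\alpha)\,\psi(0)-\sin(\alpha)\,\psi'(0)=0$ at the root. Assume that $-\Delta_{\mathbb{T}}$ is self-adjoint or that $\inf_e L_e>0$. Let $z\in\mathbb{C}$ with $\operatorname{Im}z>0$. Cutting $\mathbb{T}$ at a point $u$ of an edge produces the forward subtree $\mathbb{T}^+_u$ and the backward subtree $\mathbb{T}^-_u$,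 the latter containing the root; both contain $u$, as an open vertex with one adjacent edge. A point is given by an edge $e$ and a coordinate $l\in[0,L_e]$; as a cut point, $u=(e,l)$ is required to satisfy $l<L_e$ for $\mathbb{T}^+_u$ and $l>0$ for $\mathbb{T}^-_u$. Then the following holds. 1. For every such $u$, the space of square-integrable solutions of $-\psi''=z\psi$ on $\mathbb{T}^+_u$ (in $H^2$ on each edge, continuous and satisfying the Kirchhoff conditions at the inner vertices, with no condition at $u$) is one-dimensional, and so is the corresponding space on $\mathbb{T}^-_u$, where the condition with parameter $\alpha$ is imposed at the root. Each contains a solution $\psi^{\pm}(\cdot;z|u)$ normalized by $\psi^{\pm}(u;z|u)=1$. 2. For every $x$, the ratio $$R^+(x;z):=\frac{1}{\psi^+(x;z|u)}\,\frac{\partial}{\partial x}\psi^+(x;z|u)$$ is well defined, i.e. $\psi^+(x;z|u)\ne0$, and takes the same value for all cut points $u$ with $x\in\mathbb{T}^+_u$. 3. For every $x$ (other than the root, if $\alpha=0$), the ratio $$R^-(x;z):=-\frac{1}{\psi^-(x;z|u)}\,\frac{\partial}{\partial x}\psi^-(x;z|u)$$ is well defined, i.e. $\psi^-(x;z|u)\ne0$,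 and takes the same value for all cut points $u$ such that $x$ lies on the path from the root to $u$ ($x=u$ included), i.e. $x\in\mathbb{T}^-_u$ and $u\in\mathbb{T}^+_x$. For the remaining cut points $u$ with $x\in\mathbb{T}^-_u$, those on other branches than $x$, one also has $\psi^-(x;z|u)\neq 0$, and the ratio $-\frac{1}{\psi^-(x;z|u)}\frac{\partial}{\partial x}\psi^-(x;z|u)$ does not depend on $u$ either; there it equals $-R^+(x;z)$. -/

import Mathlib

open MeasureTheory Set

/-- The edges of the rooted tree with branching number `K`, addressed by words over `Fin K`: the
empty word `[]` is the unique edge at the root, and the `K` edges following `e` at its far end are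
`k :: e` with `k : Fin K`. The edges `f` lying in the forward direction of `e` (`f = e` included)
are those with `e <:+ f`. Besides the root, the vertices are the far ends of the edges. -/
abbrev TreeEdge (K : ℕ) : Type := List (Fin K)

/-- A rooted metric tree graph with branching number `K`: each edge `e` carries a positive finite
length and is parametrized by `[0, length e]`, the coordinate increasing away from the root. -/
structure MetricTree (K : ℕ) where
  length : TreeEdge K → ℝ
  length_pos : ∀ e, 0 < length e

namespace MetricTree

variable {K : ℕ} (T : MetricTree K)

/-- A point of a closed edge. The two endpoints of an edge are kept together with the edge along
which they are approached, so that `ψ'` has a meaning there as a one-sided derivative. -/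
structure Point where
  edge : TreeEdge K
  coord : ℝ
  coord_nonneg : 0 ≤ coord
  coord_le : coord ≤ T.length edge

/-- The whole tree, as the family of its edges `[0, length e]`. A subgraph is in the same way given
by the part `G e` of each edge `e` which belongs to it. -/
def whole (e : TreeEdge K) : Set ℝ := Icc 0 (T.length e)

/-- The forward subtree `T⁺_u`, produced by cutting the tree at `u`. -/
def plus (u : T.Point) (e : TreeEdge K) : Set ℝ :=
  open Classical in
  if e = u.edge then Icc u.coord (T.length e)
  else if u.edge <:+ e then Icc 0 (T.length e) else ∅

/-- The backward subtree `T⁻_u` (containing the root), produced by cutting the tree at `u`. -/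
def minus (u : T.Point) (e : TreeEdge K) : Set ℝ :=
  open Classical in
  if e = u.edge then Icc 0 u.coord
  else if u.edge <:+ e then ∅ else Icc 0 (T.length e)

/-- The derivative along the edge `e`, away from the root, of a function on the subgraph `G`
(one-sided at the endpoints of `G e`). -/
noncomputable def edgeDeriv (G : TreeEdge K → Set ℝ) (ψ : TreeEdge K → ℝ → ℂ)
    (e : TreeEdge K) (s : ℝ) : ℂ :=
  derivWithin (ψ e) (G e) s

/-- On each edge part `G e` (an interval) `ψ` belongs to the Sobolev space `H²`, with second
derivative `η`: `ψ` is differentiable, and its derivative is the integral of the square-integrable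
function `η`. -/
structure IsH2On (G : TreeEdge K → Set ℝ) (ψ η : TreeEdge K → ℝ → ℂ) : Prop where
  memLp : ∀ e, MemLp (η e) 2 (volume.restrict (G e))
  differentiableOn : ∀ e, DifferentiableOn ℝ (ψ e) (G e)
  integral_eq : ∀ e, ∀ s ∈ G e, ∀ t ∈ G e,
    edgeDeriv G ψ e t - edgeDeriv G ψ e s = ∫ r in s..t, η e r

/-- `ψ ∈ ⨁ₑ L²(G e)`. -/
def IsL2On (G : TreeEdge K → Set ℝ) (ψ : TreeEdge K → ℝ → ℂ) : Prop :=
  (∀ e, MemLp (ψ e) 2 (volume.restrict (G e))) ∧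
    Summable fun e => ∫ s in G e, ‖ψ e s‖ ^ 2

/-- Continuity and the Kirchhoff condition at every vertex of the tree which is an inner vertex of
the subgraph `G`, i.e. at which the ends of all the `K + 1` adjacent edges belong to `G`. -/
def Kirchhoff (G : TreeEdge K → Set ℝ) (ψ : TreeEdge K → ℝ → ℂ) : Prop :=
  ∀ e, T.length e ∈ G e → (∀ k : Fin K, (0 : ℝ) ∈ G (k :: e)) →
    (∀ k : Fin K, ψ (k :: e) 0 = ψ e (T.length e)) ∧
    edgeDeriv G ψ e (T.length e) = ∑ k : Fin K, edgeDeriv G ψ (k :: e) 0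

/-- The boundary condition `cos α · ψ(0) - sin α · ψ'(0) = 0` at the root. -/
def RootCondition (G : TreeEdge K → Set ℝ) (α : ℝ) (ψ : TreeEdge K → ℝ → ℂ) : Prop :=
  (Real.cos α : ℂ) * ψ [] 0 - (Real.sin α : ℂ) * edgeDeriv G ψ [] 0 = 0

theorem IsH2On.add {G : TreeEdge K → Set ℝ} {ψ η ψ' η' : TreeEdge K → ℝ → ℂ}
    (hG : ∀ e, ∃ a b, G e = Icc a b)
    (h : IsH2On G ψ η) (h' : IsH2On G ψ' η') :
    IsH2On G (fun e s => ψ e s + ψ' e s) (fun e s => η e s + η' e s) := by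
  have key : ∀ e, ∀ s ∈ G e, edgeDeriv G (fun e s => ψ e s + ψ' e s) e s
      = edgeDeriv G ψ e s + edgeDeriv G ψ' e s := fun e s hs =>
    derivWithin_fun_add (h.differentiableOn e s hs) (h'.differentiableOn e s hs)
  refine ⟨fun e => (h.memLp e).add (h'.memLp e),
    fun e => (h.differentiableOn e).add (h'.differentiableOn e), fun e s hs t ht => ?_⟩
  have int : ∀ {f : ℝ → ℂ}, MemLp f 2 (volume.restrict (G e)) →
      IntervalIntegrable f volume s t := fun {f} hf => by
    obtain ⟨a, b, hab⟩ := hG e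
    rw [hab] at hs ht hf
    have h1 : IntegrableOn f (Icc a b) volume := hf.integrable (by norm_num)
    exact (h1.mono_set (ordConnected_Icc.uIcc_subset hs ht)).intervalIntegrable
  rw [key e s hs, key e t ht, intervalIntegral.integral_add (int (h.memLp e)) (int (h'.memLp e)),
    ← h.integral_eq e s hs t ht, ← h'.integral_eq e s hs t ht]
  ring

theorem IsH2On.const_mul {G : TreeEdge K → Set ℝ} {ψ η : TreeEdge K → ℝ → ℂ}
    (h : IsH2On G ψ η) (c : ℂ) :
    IsH2On G (fun e s => c * ψ e s) (fun e s => c * η e s) := by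
  have key : ∀ e, ∀ s ∈ G e, edgeDeriv G (fun e s => c * ψ e s) e s
      = c * edgeDeriv G ψ e s := fun e s hs =>
    derivWithin_const_mul c (h.differentiableOn e s hs)
  refine ⟨fun e => (h.memLp e).const_mul c,
    fun e => (h.differentiableOn e).const_mul c, fun e s hs t ht => ?_⟩
  rw [key e s hs, key e t ht, intervalIntegral.integral_const_mul, ← h.integral_eq e s hs t ht]
  ring

theorem IsH2On.congr {G : TreeEdge K → Set ℝ} {ψ η η' : TreeEdge K → ℝ → ℂ}
    (hG : ∀ e, ∃ a b, G e = Icc a b) (h : IsH2On G ψ η)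
    (hη : ∀ e, η e =ᵐ[volume.restrict (G e)] η' e) : IsH2On G ψ η' := by
  refine ⟨fun e => (memLp_congr_ae (hη e)).1 (h.memLp e), h.differentiableOn,
    fun e s hs t ht => ?_⟩
  rw [h.integral_eq e s hs t ht]
  refine intervalIntegral.integral_congr_ae_restrict ?_
  obtain ⟨a, b, hab⟩ := hG e
  have h1 := hη e
  rw [hab] at hs ht h1
  exact ae_restrict_of_ae_restrict_of_subset
    (uIoc_subset_uIcc.trans (ordConnected_Icc.uIcc_subset hs ht)) h1

/-- The Hilbert space `L²(T) = ⨁ₑ L²[0, length e]`. -/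
abbrev L2 : Type :=
  lp (fun e : TreeEdge K => Lp ℂ 2 (volume.restrict (T.whole e))) 2

/-- The graph of the Laplacian `-Δ` on the tree: the pairs `(ψ, -ψ'')` in `L²(T)`, where `ψ` is in
`H²` on each edge, continuous, and satisfies the Kirchhoff conditions at the inner vertices and the
`α` boundary condition at the root. -/
noncomputable def laplacianGraph (α : ℝ) : Submodule ℂ (T.L2 × T.L2) where
  carrier := {p | ∃ ψ : TreeEdge K → ℝ → ℂ,
    (∀ e, (p.1 e : ℝ → ℂ) =ᵐ[volume.restrict (T.whole e)] ψ e) ∧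
    IsH2On T.whole ψ (fun e s => -(p.2 e : ℝ → ℂ) s) ∧
    T.Kirchhoff T.whole ψ ∧ RootCondition T.whole α ψ}
  zero_mem' := by
    have h0 : ∀ e : TreeEdge K, (((0 : T.L2 × T.L2).1 e : Lp ℂ 2 _) : ℝ → ℂ)
        =ᵐ[volume.restrict (T.whole e)] fun _ => 0 := fun e => Lp.coeFn_zero ..
    have hd : ∀ e s, edgeDeriv T.whole (fun _ _ => (0 : ℂ)) e s = 0 := fun e s => by
      simp [edgeDeriv]
    refine ⟨fun _ _ => 0, h0, ?_, ?_, ?_⟩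
    · refine IsH2On.congr (η := fun _ _ => 0) (fun e => ⟨_, _, rfl⟩) ⟨fun e => MemLp.zero,
        fun e => differentiableOn_const 0, fun e s _ t _ => by simp [hd]⟩ fun e => ?_
      filter_upwards [h0 e] with s hs
      exact (neg_eq_zero.2 hs).symm
    · intro e _ _
      simp [hd]
    · simp [RootCondition, hd]
  add_mem' := by
    rintro p q ⟨ψ, hψ, h2, hk, hr⟩ ⟨φ, hφ, h2', hk', hr'⟩
    have hd : ∀ e, ∀ s ∈ T.whole e, edgeDeriv T.whole (fun e s => ψ e s + φ e s) e s
        = edgeDeriv T.whole ψ e s + edgeDeriv T.whole φ e s := fun e s hs =>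
      derivWithin_fun_add (h2.differentiableOn e s hs) (h2'.differentiableOn e s hs)
    have h0 : ∀ e, (0 : ℝ) ∈ T.whole e := fun e => ⟨le_rfl, (T.length_pos e).le⟩
    have hl : ∀ e, T.length e ∈ T.whole e := fun e => ⟨(T.length_pos e).le, le_rfl⟩
    refine ⟨fun e s => ψ e s + φ e s, fun e => ?_, ?_, fun e h1 h3 => ?_, ?_⟩
    · filter_upwards [Lp.coeFn_add (p.1 e) (q.1 e), hψ e, hφ e] with s ha hb hc
      exact ha.trans (by rw [Pi.add_apply, hb, hc])
    · refine IsH2On.congr (fun e => ⟨_, _, rfl⟩) (h2.add (fun e => ⟨_, _, rfl⟩) h2') fun e => ?_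
      filter_upwards [Lp.coeFn_add (p.2 e) (q.2 e)] with s ha
      have hb : (((p + q).2 e : Lp ℂ 2 _) : ℝ → ℂ) s
        = (p.2 e : ℝ → ℂ) s + (q.2 e : ℝ → ℂ) s := ha
      rw [hb]
      ring
    · refine ⟨fun k => ?_, ?_⟩
      · simp only [(hk e h1 h3).1 k, (hk' e h1 h3).1 k]
      · rw [hd e _ (hl e), (hk e h1 h3).2, (hk' e h1 h3).2, ← Finset.sum_add_distrib]
        exact Finset.sum_congr rfl fun k _ => (hd _ _ (h0 _)).symm
    · unfold RootCondition at hr hr' ⊢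
      rw [hd _ _ (h0 _)]
      linear_combination hr + hr'
  smul_mem' := by
    rintro c p ⟨ψ, hψ, h2, hk, hr⟩
    have hd : ∀ e, ∀ s ∈ T.whole e, edgeDeriv T.whole (fun e s => c * ψ e s) e s
        = c * edgeDeriv T.whole ψ e s := fun e s hs =>
      derivWithin_const_mul c (h2.differentiableOn e s hs)
    have h0 : ∀ e, (0 : ℝ) ∈ T.whole e := fun e => ⟨le_rfl, (T.length_pos e).le⟩
    have hl : ∀ e, T.length e ∈ T.whole e := fun e => ⟨(T.length_pos e).le, le_rfl⟩
    refine ⟨fun e s => c * ψ e s, fun e => ?_, ?_, fun e h1 h3 => ?_, ?_⟩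
    · filter_upwards [Lp.coeFn_smul c (p.1 e), hψ e] with s ha hb
      exact ha.trans (by rw [Pi.smul_apply, hb, smul_eq_mul])
    · refine IsH2On.congr (fun e => ⟨_, _, rfl⟩) (h2.const_mul c) fun e => ?_
      filter_upwards [Lp.coeFn_smul c (p.2 e)] with s ha
      have hb : (((c • p).2 e : Lp ℂ 2 _) : ℝ → ℂ) s = c * (p.2 e : ℝ → ℂ) s := ha
      rw [hb]
      ring
    · refine ⟨fun k => ?_, ?_⟩
      · simp only [(hk e h1 h3).1 k]
      · rw [hd e _ (hl e), (hk e h1 h3).2, Finset.mul_sum]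
        exact Finset.sum_congr rfl fun k _ => (hd _ _ (h0 _)).symm
    · unfold RootCondition at hr ⊢
      rw [hd _ _ (h0 _)]
      linear_combination c * hr

/-- The Laplacian `-Δ` on the tree as an unbounded operator in `L²(T)`. -/
noncomputable def laplacian (α : ℝ) : T.L2 →ₗ.[ℂ] T.L2 :=
  (T.laplacianGraph α).toLinearPMap

/-- `ψ` is a square-integrable solution of `-ψ'' = z ψ` on the forward subtree `T⁺_u`; no condition
is imposed at the open vertex `u`. -/
structure IsSolutionPlus (z : ℂ) (u : T.Point) (ψ : TreeEdge K → ℝ → ℂ) : Prop where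
  isL2On : IsL2On (T.plus u) ψ
  isH2On : IsH2On (T.plus u) ψ (fun e s => -(z * ψ e s))
  kirchhoff : T.Kirchhoff (T.plus u) ψ

/-- `ψ` is a square-integrable solution of `-ψ'' = z ψ` on the backward subtree `T⁻_u`, with the
`α` boundary condition at the root; no condition is imposed at the open vertex `u`. -/
structure IsSolutionMinus (α : ℝ) (z : ℂ) (u : T.Point) (ψ : TreeEdge K → ℝ → ℂ) : Prop where
  isL2On : IsL2On (T.minus u) ψ
  isH2On : IsH2On (T.minus u) ψ (fun e s => -(z * ψ e s))
  kirchhoff : T.Kirchhoff (T.minus u) ψ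
  rootCondition : RootCondition (T.minus u) α ψ

/-- `ψ` is `ψ⁺(· ; z | u)`: the solution on `T⁺_u` normalized by `ψ(u) = 1`. -/
def IsPsiPlus (z : ℂ) (u : T.Point) (ψ : TreeEdge K → ℝ → ℂ) : Prop :=
  T.IsSolutionPlus z u ψ ∧ ψ u.edge u.coord = 1

/-- `ψ` is `ψ⁻(· ; z | u)`: the solution on `T⁻_u` normalized by `ψ(u) = 1`. -/
def IsPsiMinus (α : ℝ) (z : ℂ) (u : T.Point) (ψ : TreeEdge K → ℝ → ℂ) : Prop :=
  T.IsSolutionMinus α z u ψ ∧ ψ u.edge u.coord = 1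

end MetricTree

/-!
The argument is elementary and uses no resolvent. On an edge every solution of `-ψ'' = z ψ` is
determined by its Cauchy data `(p, q)` at the initial point (`sol z p q`, with derivative
`dsol z p q`), and the current `Im (conj ψ * ψ')` decreases along the edge by `Im z` times the
integral of `|ψ|²` (`current_sub`). By the Kirchhoff conditions the current is conserved at the
vertices.

*Existence on the forward subtrees* holds for every tree. Choosing the logarithmic derivatives
`R e` at the initial points of the edges amounts to solving the Riccati recursion of `IsWeyl` in the
upper half plane. It can be solved backwards on finitely many generations, with values in discs
which depend on the edge only (`exists_weyl_bound`), so compactness of the product of these discs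
gives a solution `R` on the whole tree (`exists_isWeyl`). The solution `ψ` with these logarithmic
derivatives has no zeros (`IsWeyl.sol_ne_zero`), and conservation of the current makes it square
integrable (`IsWeyl.isForward`).

*Uniqueness on the forward subtrees* is where the hypothesis on the tree enters. It ensures that the
current of a square-integrable solution through the far end of an edge is never negative
(`NoInflow`). If the edge lengths are bounded below, the total current through the `n`-th generation
is bounded by the square norm of the solution there, which tends to `0` (`noInflow_of_le_length`).
If the Laplacian is self-adjoint, its symmetry is tested with the solution itself, modified on one
edge (`noInflow_of_isSelfAdjoint`). A solution vanishing at the cut then has zero current there, and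
therefore vanishes on the whole subtree (`NoInflow.eq_zero`). Hence all square-integrable solutions
on forward subtrees are multiples of one function, whose logarithmic derivative is `R⁺`.

*On the backward subtrees* a solution is fixed, up to a factor, by the condition at the root, since
on each branch which leaves the path from the root to the cut it is a multiple of the forward
solution (`IsSolutionMinus.exists_smul`). On the path this leaves one recursion for the Cauchy data
(`pathData`), which does not involve the cut. The current along the path vanishes at the root and
decreases afterwards (`current_pathData`), so that the solution has no zeros on the path, except at
the root under the Dirichlet condition; nor on the branches, where it is a nonzero multiple of the
forward solution.
-/

namespace MetricTree

variable {K : ℕ} (T : MetricTree K)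

/-! ### Solutions on one edge -/

/-- The solution of `-ψ'' = z ψ` on the line with Cauchy data `ψ 0 = p`, `ψ' 0 = q`, for `z ≠ 0`.
It does not depend on the branch of the square root; `((2 : ℕ) : ℂ)⁻¹` is the form of the exponent
in `Complex.cpow_nat_inv_pow`. -/
noncomputable def sol (z p q : ℂ) (t : ℝ) : ℂ :=
  p * Complex.cos (z ^ ((2 : ℕ) : ℂ)⁻¹ * t) +
    q * (Complex.sin (z ^ ((2 : ℕ) : ℂ)⁻¹ * t) / z ^ ((2 : ℕ) : ℂ)⁻¹)

/-- The derivative of `sol z p q`. -/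
noncomputable def dsol (z p q : ℂ) (t : ℝ) : ℂ :=
  q * Complex.cos (z ^ ((2 : ℕ) : ℂ)⁻¹ * t) -
    z * p * (Complex.sin (z ^ ((2 : ℕ) : ℂ)⁻¹ * t) / z ^ ((2 : ℕ) : ℂ)⁻¹)

@[simp] theorem sol_zero (z p q : ℂ) : sol z p q 0 = p := by simp [sol]

@[simp] theorem dsol_zero (z p q : ℂ) : dsol z p q 0 = q := by simp [dsol]

theorem sol_smul (z c p q : ℂ) (t : ℝ) : sol z (c * p) (c * q) t = c * sol z p q t := by
  simp only [sol]; ring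

theorem dsol_smul (z c p q : ℂ) (t : ℝ) : dsol z (c * p) (c * q) t = c * dsol z p q t := by
  simp only [dsol]; ring

theorem sol_sub (z p q p' q' : ℂ) (t : ℝ) :
    sol z (p - p') (q - q') t = sol z p q t - sol z p' q' t := by
  simp only [sol]; ring

theorem dsol_sub (z p q p' q' : ℂ) (t : ℝ) :
    dsol z (p - p') (q - q') t = dsol z p q t - dsol z p' q' t := by
  simp only [dsol]; ring

theorem sqrt_sq (z : ℂ) : (z ^ ((2 : ℕ) : ℂ)⁻¹) ^ 2 = z :=
  Complex.cpow_nat_inv_pow z two_ne_zero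

theorem sqrt_ne_zero {z : ℂ} (hz : z ≠ 0) : z ^ ((2 : ℕ) : ℂ)⁻¹ ≠ 0 := fun h => by
  have := sqrt_sq z
  rw [h] at this
  exact hz (by rw [← this]; ring)

theorem hasDerivAt_cos (κ : ℂ) (t : ℝ) :
    HasDerivAt (fun s : ℝ => Complex.cos (κ * s)) (-Complex.sin (κ * t) * κ) t := by
  have h1 : HasDerivAt (fun s : ℂ => κ * s) κ (t : ℂ) := by
    simpa using (hasDerivAt_id (t : ℂ)).const_mul κ
  exact h1.ccos.comp_ofReal

theorem hasDerivAt_sin (κ : ℂ) (t : ℝ) :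
    HasDerivAt (fun s : ℝ => Complex.sin (κ * s)) (Complex.cos (κ * t) * κ) t := by
  have h1 : HasDerivAt (fun s : ℂ => κ * s) κ (t : ℂ) := by
    simpa using (hasDerivAt_id (t : ℂ)).const_mul κ
  exact h1.csin.comp_ofReal

theorem hasDerivAt_sol {z : ℂ} (hz : z ≠ 0) (p q : ℂ) (t : ℝ) :
    HasDerivAt (sol z p q) (dsol z p q t) t := by
  have hκ := sqrt_ne_zero hz
  have h := ((hasDerivAt_cos (z ^ ((2 : ℕ) : ℂ)⁻¹) t).const_mul p).add
    (((hasDerivAt_sin (z ^ ((2 : ℕ) : ℂ)⁻¹) t).div_const (z ^ ((2 : ℕ) : ℂ)⁻¹)).const_mul q)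
  refine h.congr_deriv ?_
  have h2 := sqrt_sq z
  simp only [dsol]
  generalize z ^ ((2 : ℕ) : ℂ)⁻¹ = κ at *
  subst h2
  field_simp
  ring

theorem hasDerivAt_dsol {z : ℂ} (hz : z ≠ 0) (p q : ℂ) (t : ℝ) :
    HasDerivAt (dsol z p q) (-(z * sol z p q t)) t := by
  have hκ := sqrt_ne_zero hz
  have h := ((hasDerivAt_cos (z ^ ((2 : ℕ) : ℂ)⁻¹) t).const_mul q).sub
    (((hasDerivAt_sin (z ^ ((2 : ℕ) : ℂ)⁻¹) t).div_const (z ^ ((2 : ℕ) : ℂ)⁻¹)).const_mul (z * p))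
  refine h.congr_deriv ?_
  have h2 := sqrt_sq z
  simp only [sol]
  generalize z ^ ((2 : ℕ) : ℂ)⁻¹ = κ at *
  subst h2
  field_simp
  ring

theorem continuous_sol {z : ℂ} (hz : z ≠ 0) (p q : ℂ) : Continuous (sol z p q) :=
  continuous_iff_continuousAt.2 fun t => (hasDerivAt_sol hz p q t).continuousAt

/-- The Cauchy data at `0` recovered from those at `t`. -/
theorem data_eq {z : ℂ} (hz : z ≠ 0) (p q : ℂ) (t : ℝ) :
    p = sol z 1 0 t * sol z p q t - sol z 0 1 t * dsol z p q t ∧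
      q = z * sol z 0 1 t * sol z p q t + sol z 1 0 t * dsol z p q t := by
  have hκ := sqrt_ne_zero hz
  have h2 := sqrt_sq z
  have h3 := Complex.sin_sq_add_cos_sq (z ^ ((2 : ℕ) : ℂ)⁻¹ * t)
  simp only [sol, dsol]
  generalize z ^ ((2 : ℕ) : ℂ)⁻¹ = κ at *
  subst h2
  constructor
  · field_simp
    linear_combination (-p * κ ^ 2) * h3
  · field_simp
    linear_combination (-q * κ) * h3

theorem data_eq_zero {z : ℂ} (hz : z ≠ 0) {p q : ℂ} {t : ℝ} (h : sol z p q t = 0)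
    (h' : dsol z p q t = 0) : p = 0 ∧ q = 0 := by
  have := data_eq hz p q t
  rw [h, h'] at this
  simpa using this

/-- The probability current `Im (conj a * b)` of Cauchy data `(a, b)`. -/
noncomputable def current (a b : ℂ) : ℝ := (starRingEnd ℂ a * b).im

theorem current_eq (a b : ℂ) : current a b = a.re * b.im - a.im * b.re := by
  simp [current]; ring

theorem current_mul_self (a s : ℂ) : current a (s * a) = s.im * ‖a‖ ^ 2 := by
  rw [current_eq, ← Complex.normSq_eq_norm_sq, Complex.normSq_apply]
  simp; ring

theorem hasDerivAt_current {z : ℂ} (hz : z ≠ 0) (p q : ℂ) (t : ℝ) :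
    HasDerivAt (fun s => current (sol z p q s) (dsol z p q s))
      (-(z.im * ‖sol z p q t‖ ^ 2)) t := by
  have h := (hasDerivAt_sol hz p q t).star.mul (hasDerivAt_dsol hz p q t)
  have h' := Complex.imCLM.hasFDerivAt.comp_hasDerivAt t h
  refine h'.congr_deriv ?_
  rw [← Complex.normSq_eq_norm_sq, Complex.normSq_apply]
  simp
  ring

/-- The current drops along an edge by `Im z` times the square norm of the solution. -/
theorem current_sub {z : ℂ} (hz : z ≠ 0) (p q : ℂ) (a b : ℝ) :
    current (sol z p q a) (dsol z p q a) - current (sol z p q b) (dsol z p q b) =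
      z.im * ∫ t in a..b, ‖sol z p q t‖ ^ 2 := by
  have h := intervalIntegral.integral_eq_sub_of_hasDerivAt (a := a) (b := b)
    (fun t _ => hasDerivAt_current hz p q t)
    (((continuous_const.mul ((continuous_sol hz p q).norm.pow 2)).neg).intervalIntegrable a b)
  rw [intervalIntegral.integral_neg, intervalIntegral.integral_const_mul] at h
  linarith

theorem integral_sol_nonneg (z p q : ℂ) {a b : ℝ} (hab : a ≤ b) :
    0 ≤ ∫ t in a..b, ‖sol z p q t‖ ^ 2 :=
  intervalIntegral.integral_nonneg hab fun _ _ => by positivity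

theorem integral_sol_pos {z : ℂ} (hz : z ≠ 0) {p q : ℂ} (hpq : ¬ (p = 0 ∧ q = 0)) {a b : ℝ}
    (hab : a < b) : 0 < ∫ t in a..b, ‖sol z p q t‖ ^ 2 := by
  refine intervalIntegral.integral_pos hab ((continuous_sol hz p q).norm.pow 2).continuousOn
    (fun _ _ => by positivity) ?_
  by_contra! h
  have h0 : ∀ t ∈ Icc a b, sol z p q t = 0 := fun t ht => by
    have := h t ht
    have h1 : ‖sol z p q t‖ ^ 2 = 0 := le_antisymm this (by positivity)
    simpa using h1
  have hd : HasDerivWithinAt (sol z p q) 0 (Icc a b) a :=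
    (hasDerivWithinAt_const a (Icc a b) (0 : ℂ)).congr h0 (h0 a ⟨le_rfl, hab.le⟩)
  have := (uniqueDiffOn_Icc hab a ⟨le_rfl, hab.le⟩).eq_deriv _ hd
    (hasDerivAt_sol hz p q a).hasDerivWithinAt
  exact hpq (data_eq_zero hz (h0 a ⟨le_rfl, hab.le⟩) this.symm)

/-- A solution in `H²` on a nondegenerate interval is one of the solutions `sol z p q`. -/
theorem IsH2On.exists_sol {G : TreeEdge K → Set ℝ} {ψ : TreeEdge K → ℝ → ℂ} {z : ℂ} (hz : z ≠ 0)
    (h : IsH2On G ψ (fun e s => -(z * ψ e s))) {e : TreeEdge K} {a b : ℝ} (hab : a < b)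
    (hG : G e = Icc a b) :
    ∃ p q, ∀ t ∈ Icc a b, ψ e t = sol z p q t ∧ edgeDeriv G ψ e t = dsol z p q t := by
  have hdiff := h.differentiableOn e
  rw [hG] at hdiff
  have hd1 : ∀ t ∈ Icc a b, HasDerivWithinAt (ψ e) (edgeDeriv G ψ e t) (Icc a b) t := fun t ht => by
    have := (hdiff t ht).hasDerivWithinAt
    rwa [edgeDeriv, hG]
  have hcont : ContinuousOn (fun t => -(z * ψ e t)) (Icc a b) :=
    (continuousOn_const.mul hdiff.continuousOn).neg
  have hmem : a ∈ Icc a b := ⟨le_rfl, hab.le⟩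
  have hd2 : ∀ t ∈ Icc a b,
      HasDerivWithinAt (edgeDeriv G ψ e) (-(z * ψ e t)) (Icc a b) t := fun t ht => by
    have hint : IntervalIntegrable (fun t => -(z * ψ e t)) volume a t :=
      (hcont.mono (Icc_subset_Icc le_rfl ht.2)).intervalIntegrable_of_Icc ht.1
    have : Fact (t ∈ Icc a b) := ⟨ht⟩
    have h1 : HasDerivWithinAt (fun u => ∫ x in a..u, -(z * ψ e x)) (-(z * ψ e t)) (Icc a b) t :=
      intervalIntegral.integral_hasDerivWithinAt_right hint
        (hcont.stronglyMeasurableAtFilter_nhdsWithin measurableSet_Icc t) (hcont t ht)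
    refine (h1.const_add (edgeDeriv G ψ e a)).congr (fun s hs => ?_) ?_
    · rw [← h.integral_eq e a (hG ▸ hmem) s (hG ▸ hs)]; ring
    · rw [← h.integral_eq e a (hG ▸ hmem) t (hG ▸ ht)]; ring
  -- variation of constants: the would-be data at `0` have vanishing derivative
  set C := sol z 1 0
  set S := sol z 0 1
  have hC : ∀ t, HasDerivAt C (-(z * S t)) t := fun t =>
    (hasDerivAt_sol hz 1 0 t).congr_deriv (by simp [S, sol, dsol])
  have hS : ∀ t, HasDerivAt S (C t) t := fun t =>
    (hasDerivAt_sol hz 0 1 t).congr_deriv (by simp [C, sol, dsol])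
  have hp : ∀ t ∈ Icc a b, HasDerivWithinAt (fun t => C t * ψ e t - S t * edgeDeriv G ψ e t) 0
      (Icc a b) t := fun t ht =>
    (((hC t).hasDerivWithinAt.mul (hd1 t ht)).sub
      ((hS t).hasDerivWithinAt.mul (hd2 t ht))).congr_deriv (by ring)
  have hq : ∀ t ∈ Icc a b, HasDerivWithinAt
      (fun t => z * S t * ψ e t + C t * edgeDeriv G ψ e t) 0 (Icc a b) t := fun t ht =>
    ((((hS t).hasDerivWithinAt.const_mul z).mul (hd1 t ht)).add
      ((hC t).hasDerivWithinAt.mul (hd2 t ht))).congr_deriv (by ring)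
  have hconst : ∀ f : ℝ → ℂ, (∀ t ∈ Icc a b, HasDerivWithinAt f 0 (Icc a b) t) →
      ∀ t ∈ Icc a b, f t = f a := fun f hf =>
    constant_of_derivWithin_zero (fun t ht => (hf t ht).differentiableWithinAt) fun t ht =>
      (hf t ⟨ht.1, ht.2.le⟩).derivWithin (uniqueDiffOn_Icc hab t ⟨ht.1, ht.2.le⟩)
  refine ⟨C a * ψ e a - S a * edgeDeriv G ψ e a, z * S a * ψ e a + C a * edgeDeriv G ψ e a,
    fun t ht => ?_⟩
  have e1 := hconst _ hp t ht
  have e2 := hconst _ hq t ht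
  have hw : C t ^ 2 + z * S t ^ 2 = 1 := by
    have h1 : C t = Complex.cos (z ^ ((2 : ℕ) : ℂ)⁻¹ * t) := by simp [C, sol]
    have h2 : z ^ ((2 : ℕ) : ℂ)⁻¹ * S t = Complex.sin (z ^ ((2 : ℕ) : ℂ)⁻¹ * t) := by
      simp only [S, sol, zero_mul, zero_add, one_mul]
      exact mul_div_cancel₀ _ (sqrt_ne_zero hz)
    have h3 := Complex.sin_sq_add_cos_sq (z ^ ((2 : ℕ) : ℂ)⁻¹ * t)
    rw [← h1, ← h2] at h3
    linear_combination h3 - S t ^ 2 * sqrt_sq z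
  have l1 : ∀ p q, sol z p q t = p * C t + q * S t := fun p q => by simp [C, S, sol]
  have l2 : ∀ p q, dsol z p q t = q * C t - z * p * S t := fun p q => by simp [C, S, sol, dsol]
  rw [l1, l2, ← e1, ← e2]
  constructor
  · linear_combination (-ψ e t) * hw
  · linear_combination (-edgeDeriv G ψ e t) * hw

theorem edgeDeriv_sol {z : ℂ} (hz : z ≠ 0) {G : TreeEdge K → Set ℝ} (P Q : TreeEdge K → ℂ)
    {e : TreeEdge K} {a b : ℝ} (hab : a < b) (hG : G e = Icc a b) {t : ℝ} (ht : t ∈ G e) :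
    edgeDeriv G (fun e => sol z (P e) (Q e)) e t = dsol z (P e) (Q e) t := by
  rw [hG] at ht
  rw [edgeDeriv, hG]
  exact (hasDerivAt_sol hz _ _ t).hasDerivWithinAt.derivWithin (uniqueDiffOn_Icc hab t ht)

theorem memLp_sol {z : ℂ} (hz : z ≠ 0) (p q : ℂ) (a b : ℝ) :
    MemLp (sol z p q) 2 (volume.restrict (Icc a b)) := by
  obtain ⟨C, hC⟩ := isCompact_Icc.exists_bound_of_continuousOn
    (continuous_sol hz p q).continuousOn (s := Icc a b)
  exact MemLp.of_bound (continuous_sol hz p q).aestronglyMeasurable C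
    ((ae_restrict_iff' measurableSet_Icc).2 (ae_of_all _ hC))

theorem isH2On_sol {z : ℂ} (hz : z ≠ 0) {G : TreeEdge K → Set ℝ}
    (hG : ∀ e, G e = ∅ ∨ ∃ a b, a < b ∧ G e = Icc a b) (P Q : TreeEdge K → ℂ) :
    IsH2On G (fun e => sol z (P e) (Q e)) (fun e s => -(z * sol z (P e) (Q e) s)) := by
  refine ⟨fun e => ?_, fun e => ?_, fun e s hs t ht => ?_⟩
  · rcases hG e with h | ⟨a, b, -, h⟩
    · simp [h]
    · rw [h]
      exact ((memLp_sol hz _ _ a b).const_mul z).neg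
  · exact fun t _ => (hasDerivAt_sol hz _ _ t).differentiableAt.differentiableWithinAt
  · rcases hG e with h | ⟨a, b, hab, h⟩
    · simp [h] at hs
    · rw [edgeDeriv_sol hz P Q hab h hs, edgeDeriv_sol hz P Q hab h ht]
      exact (intervalIntegral.integral_eq_sub_of_hasDerivAt
        (fun t _ => hasDerivAt_dsol hz (P e) (Q e) t)
        ((continuous_const.mul (continuous_sol hz _ _)).neg.intervalIntegrable s t)).symm

/-! ### Sums over generations -/

/-- The sum of `h` over the descendants of the edge `e` which lie `n` generations after it. -/
noncomputable def genSum (h : TreeEdge K → ℝ) (e : TreeEdge K) (n : ℕ) : ℝ :=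
  ∑ v : Fin n → Fin K, h (List.ofFn v ++ e)

theorem genSum_zero (h : TreeEdge K → ℝ) (e : TreeEdge K) : genSum h e 0 = h e := by
  simp [genSum]

theorem genSum_succ (h : TreeEdge K → ℝ) (e : TreeEdge K) (n : ℕ) :
    genSum h e (n + 1) = genSum (fun f => ∑ k : Fin K, h (k :: f)) e n := by
  unfold genSum
  rw [← (Fin.consEquiv fun _ => Fin K).sum_comp, Fintype.sum_prod_type, Finset.sum_comm]
  refine Finset.sum_congr rfl fun v _ => Finset.sum_congr rfl fun k _ => ?_
  simp [Fin.consEquiv, List.ofFn_succ]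

theorem genSum_mono {h h' : TreeEdge K → ℝ} {e : TreeEdge K}
    (hh : ∀ w, h (w ++ e) ≤ h' (w ++ e)) (n : ℕ) : genSum h e n ≤ genSum h' e n :=
  Finset.sum_le_sum fun _ _ => hh _

theorem summable_iff_genSum {h : TreeEdge K → ℝ} (h0 : ∀ f, 0 ≤ h f) (e : TreeEdge K) :
    Summable (fun w => h (w ++ e)) ↔ Summable (genSum h e) := by
  rw [← List.equivSigmaTuple.symm.summable_iff, Function.comp_def,
    summable_sigma_of_nonneg fun _ => h0 _]
  simp only [Summable.of_finite, implies_true, true_and]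
  refine summable_congr fun n => ?_
  rw [tsum_fintype]
  rfl

/-! ### Square-integrable solutions through their Cauchy data -/

/-- The square norm, on the edge `e`, of the solution with Cauchy data `P e`, `Q e` at the initial
point of `e`. -/
noncomputable def energy (z : ℂ) (P Q : TreeEdge K → ℂ) (e : TreeEdge K) : ℝ :=
  ∫ t in (0 : ℝ)..T.length e, ‖sol z (P e) (Q e) t‖ ^ 2

/-- `P` and `Q` are the Cauchy data, at the initial points of the edges `w ++ e`, of a
square-integrable solution on the forward subtree which begins with the edge `e`. -/
structure IsForward (z : ℂ) (e : TreeEdge K) (P Q : TreeEdge K → ℂ) : Prop where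
  value : ∀ w k, P (k :: (w ++ e)) = sol z (P (w ++ e)) (Q (w ++ e)) (T.length (w ++ e))
  flux : ∀ w, ∑ k, Q (k :: (w ++ e)) = dsol z (P (w ++ e)) (Q (w ++ e)) (T.length (w ++ e))
  summable : Summable fun w => T.energy z P Q (w ++ e)

variable {T}

theorem energy_nonneg (z : ℂ) (P Q : TreeEdge K → ℂ) (e : TreeEdge K) : 0 ≤ T.energy z P Q e :=
  integral_sol_nonneg z _ _ (T.length_pos e).le

theorem IsForward.append {z : ℂ} {e : TreeEdge K} {P Q : TreeEdge K → ℂ}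
    (h : T.IsForward z e P Q) (v : TreeEdge K) : T.IsForward z (v ++ e) P Q := by
  refine ⟨fun w k => ?_, fun w => ?_, ?_⟩
  · simpa using h.value (w ++ v) k
  · simpa using h.flux (w ++ v)
  · simpa [Function.comp_def] using h.summable.comp_injective (List.append_left_injective v)

theorem IsForward.sub_smul {z : ℂ} (hz : z ≠ 0) {e : TreeEdge K} {P Q P' Q' : TreeEdge K → ℂ}
    (h : T.IsForward z e P Q) (h' : T.IsForward z e P' Q') (c : ℂ) :
    T.IsForward z e (fun f => P f - c * P' f) (fun f => Q f - c * Q' f) := by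
  refine ⟨fun w k => ?_, fun w => ?_, ?_⟩
  · rw [h.value, h'.value, sol_sub, sol_smul]
  · rw [Finset.sum_sub_distrib, ← Finset.mul_sum, h.flux, h'.flux, dsol_sub, dsol_smul]
  · refine Summable.of_nonneg_of_le (fun w => energy_nonneg _ _ _ _) (fun w => ?_)
      ((h.summable.mul_left 2).add (h'.summable.mul_left (2 * ‖c‖ ^ 2)))
    have hi : ∀ p q : ℂ, IntervalIntegrable (fun t => ‖sol z p q t‖ ^ 2) volume 0
        (T.length (w ++ e)) := fun p q =>
      ((continuous_sol hz p q).norm.pow 2).intervalIntegrable _ _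
    unfold energy
    rw [← intervalIntegral.integral_const_mul, ← intervalIntegral.integral_const_mul,
      ← intervalIntegral.integral_add ((hi _ _).const_mul _) ((hi _ _).const_mul _)]
    refine intervalIntegral.integral_mono (T.length_pos _).le (hi _ _)
      (((hi _ _).const_mul _).add ((hi _ _).const_mul _)) fun t => ?_
    simp only [sol_sub, sol_smul]
    have h1 := norm_sub_le (sol z (P (w ++ e)) (Q (w ++ e)) t)
      (c * sol z (P' (w ++ e)) (Q' (w ++ e)) t)
    rw [norm_mul] at h1
    have h2 := norm_nonneg (sol z (P (w ++ e)) (Q (w ++ e)) t -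
      c * sol z (P' (w ++ e)) (Q' (w ++ e)) t)
    nlinarith [sq_nonneg (‖sol z (P (w ++ e)) (Q (w ++ e)) t‖ -
      ‖c‖ * ‖sol z (P' (w ++ e)) (Q' (w ++ e)) t‖)]

/-! ### The Weyl function of the forward subtrees -/

/-- The number `r` for which the solution on an edge of length `l` with initial value `1` and
initial derivative `r` has final logarithmic derivative `s`. -/
noncomputable def weylStep (z : ℂ) (l : ℝ) (s : ℂ) : ℂ :=
  (s * sol z 1 0 l - dsol z 1 0 l) / (dsol z 0 1 l - s * sol z 0 1 l)

theorem sol_one (z r : ℂ) (t : ℝ) : sol z 1 r t = sol z 1 0 t + r * sol z 0 1 t := by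
  simp [sol]

theorem dsol_one (z r : ℂ) (t : ℝ) : dsol z 1 r t = dsol z 1 0 t + r * dsol z 0 1 t := by
  simp [dsol]; ring

theorem current_one (r : ℂ) : current 1 r = r.im := by simp [current]

section

variable {z : ℂ} (hz : 0 < z.im)
include hz

theorem ne_zero_of_im_pos : z ≠ 0 := fun h => by simp [h] at hz

theorem weylStep_spec {l : ℝ} (hl : 0 < l) {s : ℂ} (hs : 0 ≤ s.im) :
    dsol z 1 (weylStep z l s) l = s * sol z 1 (weylStep z l s) l := by
  have hz0 := ne_zero_of_im_pos hz
  have hd : dsol z 0 1 l - s * sol z 0 1 l ≠ 0 := fun h => by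
    have h1 := current_sub hz0 0 1 0 l
    rw [sub_eq_zero.1 h, current_mul_self] at h1
    have h2 := integral_sol_pos hz0 (p := 0) (q := 1) (by simp) hl
    have h3 : current (sol z 0 1 0) (dsol z 0 1 0) = 0 := by simp [current]
    have h4 : 0 ≤ s.im * ‖sol z 0 1 l‖ ^ 2 := by positivity
    have h5 := mul_pos hz h2
    linarith
  rw [sol_one, dsol_one, weylStep]
  field_simp
  ring

theorem im_nonneg_of_riccati {l : ℝ} {r s : ℂ} (hs : 0 ≤ s.im)
    (h : dsol z 1 r l = s * sol z 1 r l) :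
    z.im * (∫ t in (0 : ℝ)..l, ‖sol z 1 r t‖ ^ 2) ≤ r.im := by
  have h1 := current_sub (ne_zero_of_im_pos hz) 1 r 0 l
  rw [h, current_mul_self, sol_zero, dsol_zero, current_one] at h1
  have h4 : 0 ≤ s.im * ‖sol z 1 r l‖ ^ 2 := by positivity
  linarith

/-- The Weyl disc of an edge, which contains all the initial logarithmic derivatives compatible with
a nonnegative current at the far end, is bounded: the left-hand side below is quadratic in `r`, the
right-hand side linear. -/
theorem exists_weyl_bound {l : ℝ} (hl : 0 < l) :
    ∃ M : ℝ, ∀ r : ℂ, z.im * (∫ t in (0 : ℝ)..l, ‖sol z 1 r t‖ ^ 2) ≤ r.im → ‖r‖ ≤ M := by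
  have hz0 := ne_zero_of_im_pos hz
  have hpos := integral_sol_pos hz0 (p := 0) (q := 1) (by simp) hl
  have hc := integral_sol_nonneg z 1 0 hl.le
  set σ := ∫ t in (0 : ℝ)..l, ‖sol z 0 1 t‖ ^ 2
  set γ := ∫ t in (0 : ℝ)..l, ‖sol z 1 0 t‖ ^ 2
  refine ⟨max 1 (2 * (1 + z.im * γ) / (z.im * σ)), fun r hr => ?_⟩
  have hi : ∀ p q : ℂ, IntervalIntegrable (fun t => ‖sol z p q t‖ ^ 2) volume 0 l := fun p q =>
    ((continuous_sol hz0 p q).norm.pow 2).intervalIntegrable _ _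
  have key : ‖r‖ ^ 2 * σ ≤ 2 * (∫ t in (0 : ℝ)..l, ‖sol z 1 r t‖ ^ 2) + 2 * γ := by
    rw [← intervalIntegral.integral_const_mul, ← intervalIntegral.integral_const_mul,
      ← intervalIntegral.integral_const_mul,
      ← intervalIntegral.integral_add ((hi _ _).const_mul _) ((hi _ _).const_mul _)]
    refine intervalIntegral.integral_mono hl.le ((hi _ _).const_mul _)
      (((hi _ _).const_mul _).add ((hi _ _).const_mul _)) fun t => ?_
    simp only
    have h1 := norm_sub_le (sol z 1 r t) (sol z 1 0 t)
    have h2 : sol z 1 r t - sol z 1 0 t = r * sol z 0 1 t := by rw [sol_one]; ring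
    rw [h2, norm_mul] at h1
    have h3 : 0 ≤ ‖r‖ * ‖sol z 0 1 t‖ := by positivity
    nlinarith [sq_nonneg (‖sol z 1 r t‖ - ‖sol z 1 0 t‖)]
  rcases le_total ‖r‖ 1 with h1 | h1
  · exact h1.trans (le_max_left _ _)
  · refine le_trans ?_ (le_max_right _ _)
    rw [le_div_iff₀ (by positivity)]
    have h2 : r.im ≤ ‖r‖ := (le_abs_self _).trans (Complex.abs_im_le_norm r)
    have h3 : z.im * (‖r‖ ^ 2 * σ) ≤ 2 * ‖r‖ + 2 * (z.im * γ) := by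
      have := mul_le_mul_of_nonneg_left key hz.le
      linarith
    have h4 : z.im * γ ≤ ‖r‖ * (z.im * γ) := le_mul_of_one_le_left (by positivity) h1
    have h5 : ‖r‖ * (‖r‖ * (z.im * σ)) ≤ ‖r‖ * (2 * (1 + z.im * γ)) := by linarith
    exact le_of_mul_le_mul_left h5 (by linarith)

end

/-- `R` assigns to each edge `e` the value at its initial point of the logarithmic derivative of a
solution on the forward subtree: a solution of the Riccati recursion with values in the closed upper
half plane. -/
structure IsWeyl (T : MetricTree K) (z : ℂ) (R : TreeEdge K → ℂ) : Prop where
  im_nonneg : ∀ e, 0 ≤ (R e).im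
  riccati : ∀ e, dsol z 1 (R e) (T.length e) = (∑ k, R (k :: e)) * sol z 1 (R e) (T.length e)

/-- The Weyl function obtained by imposing, `n` generations further on, a Neumann condition. -/
noncomputable def weylApprox (T : MetricTree K) (z : ℂ) : ℕ → TreeEdge K → ℂ
  | 0, _ => 0
  | n + 1, e => weylStep z (T.length e) (∑ k, weylApprox T z n (k :: e))

theorem im_weylApprox {z : ℂ} (hz : 0 < z.im) (n : ℕ) (e : TreeEdge K) :
    0 ≤ (weylApprox T z n e).im := by
  induction n generalizing e with
  | zero => simp [weylApprox]
  | succ n ih =>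
    have hs : 0 ≤ (∑ k, weylApprox T z n (k :: e)).im := by
      rw [Complex.im_sum]
      exact Finset.sum_nonneg fun k _ => ih _
    exact (mul_nonneg hz.le (integral_sol_nonneg z _ _ (T.length_pos e).le)).trans
      (im_nonneg_of_riccati hz hs (weylStep_spec hz (T.length_pos e) hs))

theorem weylApprox_riccati {z : ℂ} (hz : 0 < z.im) (n : ℕ) (e : TreeEdge K) :
    dsol z 1 (weylApprox T z (n + 1) e) (T.length e) =
      (∑ k, weylApprox T z n (k :: e)) * sol z 1 (weylApprox T z (n + 1) e) (T.length e) :=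
  weylStep_spec hz (T.length_pos e) (by
    rw [Complex.im_sum]
    exact Finset.sum_nonneg fun k _ => im_weylApprox hz n _)

/-- Weyl functions exist by compactness of the product of the Weyl discs: the recursion can be
solved backwards on any finite number of generations. -/
theorem exists_isWeyl (T : MetricTree K) {z : ℂ} (hz : 0 < z.im) : ∃ R, T.IsWeyl z R := by
  choose M hM using fun e : TreeEdge K => exists_weyl_bound hz (T.length_pos e)
  let X : ℕ → Set (TreeEdge K → ℂ) := fun n =>
    {R | (∀ e, R e ∈ Metric.closedBall 0 (max 0 (M e))) ∧ (∀ e, 0 ≤ (R e).im) ∧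
      ∀ e : TreeEdge K, e.length < n →
        dsol z 1 (R e) (T.length e) = (∑ k, R (k :: e)) * sol z 1 (R e) (T.length e)}
  have hclosed : ∀ n, IsClosed (X n) := fun n => by
    have h1 : IsClosed {R : TreeEdge K → ℂ | ∀ e, R e ∈ Metric.closedBall 0 (max 0 (M e))} := by
      simp only [ofPred_forall]
      exact isClosed_iInter fun e => Metric.isClosed_closedBall.preimage (continuous_apply e)
    have h2 : IsClosed {R : TreeEdge K → ℂ | ∀ e, 0 ≤ (R e).im} := by
      simp only [ofPred_forall]
      exact isClosed_iInter fun e =>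
        isClosed_le continuous_const (Complex.continuous_im.comp (continuous_apply e))
    have h3 : IsClosed {R : TreeEdge K → ℂ | ∀ e : TreeEdge K, e.length < n →
        dsol z 1 (R e) (T.length e) = (∑ k, R (k :: e)) * sol z 1 (R e) (T.length e)} := by
      simp only [ofPred_forall]
      refine isClosed_iInter fun e => isClosed_iInter fun _ => isClosed_eq ?_ ?_
      · simp only [dsol]
        fun_prop
      · simp only [sol]
        fun_prop
    exact h1.inter (h2.inter h3)
  have hcompact : IsCompact (X 0) := by
    refine (isCompact_univ_pi fun e : TreeEdge K =>
      isCompact_closedBall (0 : ℂ) (max 0 (M e))).of_isClosed_subset (hclosed 0) ?_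
    exact fun R hR e _ => hR.1 e
  have hne : ∀ n, (X n).Nonempty := fun n => by
    refine ⟨fun e => weylApprox T z (n - e.length) e, fun e => ?_,
      fun e => im_weylApprox hz _ _, fun e he => ?_⟩
    · rcases h : n - e.length with _ | m
      · simp [weylApprox, h]
      · simp only [h, mem_closedBall_zero_iff]
        refine (hM e _ ?_).trans (le_max_right _ _)
        refine im_nonneg_of_riccati hz ?_ (weylApprox_riccati hz m e)
        rw [Complex.im_sum]
        exact Finset.sum_nonneg fun k _ => im_weylApprox hz m _
    · obtain ⟨m, hm⟩ : ∃ m, n - e.length = m + 1 := ⟨n - e.length - 1, by omega⟩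
      have hm' : n - (e.length + 1) = m := by omega
      simp only [List.length_cons, hm, hm']
      exact weylApprox_riccati hz m e
  obtain ⟨R, hR⟩ := IsCompact.nonempty_iInter_of_sequence_nonempty_isCompact_isClosed X
    (fun n R hR => ⟨hR.1, hR.2.1, fun e he => hR.2.2 e (he.trans n.lt_succ_self)⟩)
    hne hcompact hclosed
  rw [mem_iInter] at hR
  exact ⟨R, (hR 0).2.1, fun e => (hR (e.length + 1)).2.2 e (Nat.lt_succ_self _)⟩

/-- The values, at the initial points of the edges, of the solution with logarithmic derivative
`R`, normalized by the value `1` at the root. -/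
noncomputable def weylValue (T : MetricTree K) (z : ℂ) (R : TreeEdge K → ℂ) : TreeEdge K → ℂ
  | [] => 1
  | _ :: e => weylValue T z R e * sol z 1 (R e) (T.length e)

section

variable {z : ℂ} {R : TreeEdge K → ℂ} (hz : 0 < z.im) (hR : T.IsWeyl z R)
include hz hR

theorem IsWeyl.sol_ne_zero {e : TreeEdge K} {t : ℝ} (ht : t ≤ T.length e) :
    sol z 1 (R e) t ≠ 0 := fun h => by
  have hz0 := ne_zero_of_im_pos hz
  rcases ht.eq_or_lt with rfl | hlt
  · have := hR.riccati e
    rw [h, mul_zero] at this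
    exact one_ne_zero (data_eq_zero hz0 h this).1
  · have h1 := current_sub hz0 1 (R e) t (T.length e)
    rw [h, hR.riccati e, current_mul_self] at h1
    have h2 := mul_pos hz (integral_sol_pos hz0 (p := 1) (q := R e) (by simp) hlt)
    have h3 : 0 ≤ (∑ k, R (k :: e)).im := by
      rw [Complex.im_sum]
      exact Finset.sum_nonneg fun k _ => hR.im_nonneg _
    have h4 : 0 ≤ (∑ k, R (k :: e)).im * ‖sol z 1 (R e) (T.length e)‖ ^ 2 := by positivity
    simp only [current, map_zero, zero_mul, Complex.zero_im] at h1
    linarith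

theorem IsWeyl.weylValue_ne_zero (e : TreeEdge K) : weylValue T z R e ≠ 0 := by
  induction e with
  | nil => exact one_ne_zero
  | cons k e ih => exact mul_ne_zero ih (hR.sol_ne_zero hz le_rfl)

/-- The solution with logarithmic derivative `R` is square integrable: by conservation of the
current, its square norm on the first generations is at most the current at the root divided by
`Im z`. -/
theorem IsWeyl.isForward (e : TreeEdge K) :
    T.IsForward z e (weylValue T z R) (fun f => weylValue T z R f * R f) := by
  have hz0 := ne_zero_of_im_pos hz
  have hsol : ∀ f t, sol z (weylValue T z R f) (weylValue T z R f * R f) t =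
      weylValue T z R f * sol z 1 (R f) t := fun f t => by
    simpa using sol_smul z (weylValue T z R f) 1 (R f) t
  have hdsol : ∀ f t, dsol z (weylValue T z R f) (weylValue T z R f * R f) t =
      weylValue T z R f * dsol z 1 (R f) t := fun f t => by
    simpa using dsol_smul z (weylValue T z R f) 1 (R f) t
  have hflux : ∀ f, ∑ k, weylValue T z R (k :: f) * R (k :: f) =
      dsol z (weylValue T z R f) (weylValue T z R f * R f) (T.length f) := fun f => by
    rw [hdsol, hR.riccati, Finset.sum_mul, Finset.mul_sum]
    refine Finset.sum_congr rfl fun k _ => ?_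
    rw [weylValue]
    ring
  refine ⟨fun w k => by rw [hsol, weylValue], fun w => hflux _, ?_⟩
  let h : TreeEdge K → ℝ := T.energy z (weylValue T z R) (fun f => weylValue T z R f * R f)
  let g : TreeEdge K → ℝ := fun f => current (weylValue T z R f) (weylValue T z R f * R f)
  have hg : ∀ f, 0 ≤ g f := fun f => by
    simp only [g]
    rw [mul_comm, current_mul_self]
    exact mul_nonneg (hR.im_nonneg f) (by positivity)
  have hstep : ∀ f, g f = z.im * h f + ∑ k, g (k :: f) := fun f => by
    have h1 := current_sub hz0 (weylValue T z R f) (weylValue T z R f * R f) 0 (T.length f)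
    rw [sol_zero, dsol_zero, ← hflux] at h1
    have h2 : current (sol z (weylValue T z R f) (weylValue T z R f * R f) (T.length f))
        (∑ k, weylValue T z R (k :: f) * R (k :: f)) = ∑ k, g (k :: f) := by
      simp only [g, current, Finset.mul_sum, Complex.im_sum, hsol, weylValue]
    rw [h2] at h1
    simp only [g, h, energy]
    linarith
  have hgen : ∀ n, genSum g e n = z.im * genSum h e n + genSum g e (n + 1) := fun n => by
    rw [genSum_succ]
    simp only [genSum, Finset.mul_sum, ← Finset.sum_add_distrib]
    exact Finset.sum_congr rfl fun v _ => hstep _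
  have h0 : ∀ f, 0 ≤ h f := fun f => energy_nonneg _ _ _ _
  refine (summable_iff_genSum h0 e).2 (summable_of_sum_range_le (c := genSum g e 0 / z.im)
    (fun n => Finset.sum_nonneg fun _ _ => h0 _) fun n => ?_)
  rw [le_div_iff₀' hz, Finset.mul_sum]
  have : ∑ i ∈ Finset.range n, z.im * genSum h e i = genSum g e 0 - genSum g e n := by
    rw [← Finset.sum_range_sub']
    exact Finset.sum_congr rfl fun i _ => by rw [hgen i]; ring
  rw [this]
  have : 0 ≤ genSum g e n := Finset.sum_nonneg fun _ _ => hg _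
  linarith

end

variable (T)

/-! ### The sign of the current of square-integrable solutions -/

/-- No square-integrable solution on a forward subtree carries a negative current through the far
end of the first edge: nothing flows in from infinity. -/
def NoInflow (z : ℂ) : Prop :=
  ∀ e P Q, T.IsForward z e P Q →
    0 ≤ current (sol z (P e) (Q e) (T.length e)) (dsol z (P e) (Q e) (T.length e))

variable {T}

/-! ### Edge lengths bounded below -/

/-- Integration by parts against `(t - (l - ℓ)) ^ (m + 2)`, which vanishes to second order at the
initial point of `[l - ℓ, l]`, bounds a combination of the data at the end point `l`. -/
theorem norm_data_le {z : ℂ} (hz : z ≠ 0) (p q : ℂ) (m : ℕ) {ℓ : ℝ} (hℓ : 0 < ℓ) (l : ℝ) :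
    ‖(ℓ : ℂ) ^ (m + 2) * dsol z p q l - (m + 2) * ℓ ^ (m + 1) * sol z p q l‖ ≤
      (‖z‖ * ℓ ^ (m + 2) + (m + 2) * (m + 1) * ℓ ^ m) *
        ∫ t in (l - ℓ)..l, ‖sol z p q t‖ := by
  have hlin : ∀ t : ℝ, HasDerivAt (fun t : ℝ => (t : ℂ) - (l - ℓ : ℝ)) 1 t := fun t => by
    simpa using (hasDerivAt_id t).ofReal_comp.sub_const ((l - ℓ : ℝ) : ℂ)
  have hd : ∀ t : ℝ, HasDerivAt (fun t : ℝ => ((t : ℂ) - (l - ℓ : ℝ)) ^ (m + 2) * dsol z p q t -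
      (m + 2) * ((t : ℂ) - (l - ℓ : ℝ)) ^ (m + 1) * sol z p q t)
      (-((z * ((t : ℂ) - (l - ℓ : ℝ)) ^ (m + 2) +
        (m + 2) * (m + 1) * ((t : ℂ) - (l - ℓ : ℝ)) ^ m) * sol z p q t)) t := fun t => by
    have h := (((hlin t).fun_pow (m + 2)).mul (hasDerivAt_dsol hz p q t)).sub
      ((((hlin t).fun_pow (m + 1)).const_mul ((m : ℂ) + 2)).mul (hasDerivAt_sol hz p q t))
    refine h.congr_deriv ?_
    simp only [Nat.add_sub_cancel, show m + 2 - 1 = m + 1 by omega]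
    push_cast
    ring
  have hc := continuous_sol hz p q
  have hint := intervalIntegral.integral_eq_sub_of_hasDerivAt (a := l - ℓ) (b := l)
    (fun t _ => hd t) (Continuous.intervalIntegrable (by fun_prop) _ _)
  have e1 : ((l : ℂ) - (l - ℓ : ℝ)) = ℓ := by push_cast; ring
  simp only [e1, sub_self, ne_eq, Nat.succ_ne_zero, not_false_eq_true, zero_pow, zero_mul,
    mul_zero, sub_zero] at hint
  rw [← hint, ← intervalIntegral.integral_const_mul]
  refine intervalIntegral.norm_integral_le_of_norm_le (by linarith) (ae_of_all _ fun t ht => ?_)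
    (Continuous.intervalIntegrable (by fun_prop) _ _)
  rw [norm_neg, norm_mul]
  refine mul_le_mul_of_nonneg_right ?_ (norm_nonneg _)
  have h0 : ‖(t : ℂ) - (l - ℓ : ℝ)‖ ≤ ℓ := by
    rw [← Complex.ofReal_sub, Complex.norm_real, Real.norm_eq_abs, abs_le]
    constructor <;> linarith [ht.1, ht.2]
  have hm : ‖((m : ℂ) + 2) * (m + 1)‖ = ((m : ℝ) + 2) * (m + 1) := by
    have : (((m : ℂ) + 2) * (m + 1)) = (((m : ℝ) + 2) * (m + 1) : ℝ) := by push_cast; ring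
    rw [this, Complex.norm_real, Real.norm_of_nonneg (by positivity)]
  refine (norm_add_le _ _).trans (add_le_add ?_ ?_)
  · rw [norm_mul, norm_pow]
    gcongr
  · rw [norm_mul, norm_pow, hm]
    gcongr

/-- On an edge of length at least `ℓ`, the current at the end point is bounded by the square norm
of the solution. -/
theorem exists_abs_current_le {z : ℂ} (hz : z ≠ 0) {ℓ : ℝ} (hℓ : 0 < ℓ) :
    ∃ C : ℝ, ∀ p q l, ℓ ≤ l → |current (sol z p q l) (dsol z p q l)| ≤
      C * ∫ t in (0 : ℝ)..l, ‖sol z p q t‖ ^ 2 := by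
  set M₂ := ‖z‖ * ℓ ^ 2 + 2 * ℓ ^ 0 with hM₂
  set M₃ := ‖z‖ * ℓ ^ 3 + 6 * ℓ ^ 1 with hM₃
  have hM₂0 : 0 ≤ M₂ := by positivity
  have hM₃0 : 0 ≤ M₃ := by positivity
  set A := (ℓ * M₂ + M₃) / ℓ ^ 2
  set B := (3 * ℓ * M₂ + 2 * M₃) / ℓ ^ 3
  refine ⟨A * B * ℓ, fun p q l hl => ?_⟩
  have h2 := norm_data_le hz p q 0 hℓ l
  have h3 := norm_data_le hz p q 1 hℓ l
  norm_num at h2 h3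
  set a := sol z p q l
  set b := dsol z p q l
  set N := ∫ t in (l - ℓ)..l, ‖sol z p q t‖
  have hc := continuous_sol hz p q
  have hN0 : 0 ≤ N := intervalIntegral.integral_nonneg (by linarith) fun _ _ => norm_nonneg _
  replace h2 : ‖(ℓ : ℂ) ^ 2 * b - 2 * ℓ * a‖ ≤ M₂ * N := by simpa [hM₂] using h2
  replace h3 : ‖(ℓ : ℂ) ^ 3 * b - 3 * ℓ ^ 2 * a‖ ≤ M₃ * N := by
    refine le_of_eq_of_le ?_ (h3.trans_eq ?_)
    · congr 2
    · rw [hM₃]; ring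
  have hℓn : ‖(ℓ : ℂ)‖ = ℓ := by simp [abs_of_pos hℓ]
  have ha : ‖a‖ ≤ A * N := by
    have h : (ℓ : ℂ) ^ 2 * a = ℓ * (ℓ ^ 2 * b - 2 * ℓ * a) - (ℓ ^ 3 * b - 3 * ℓ ^ 2 * a) := by
      ring
    have h' : ‖(ℓ : ℂ) ^ 2 * a‖ ≤ ℓ * (M₂ * N) + M₃ * N := by
      rw [h]
      refine (norm_sub_le _ _).trans (add_le_add ?_ h3)
      rw [norm_mul, hℓn]
      gcongr
    rw [norm_mul, norm_pow, hℓn] at h'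
    rw [div_mul_eq_mul_div, le_div_iff₀' (by positivity)]
    linarith
  have hb : ‖b‖ ≤ B * N := by
    have h : (ℓ : ℂ) ^ 3 * b =
        3 * ℓ * (ℓ ^ 2 * b - 2 * ℓ * a) - 2 * (ℓ ^ 3 * b - 3 * ℓ ^ 2 * a) := by
      ring
    have h' : ‖(ℓ : ℂ) ^ 3 * b‖ ≤ 3 * ℓ * (M₂ * N) + 2 * (M₃ * N) := by
      rw [h]
      refine (norm_sub_le _ _).trans (add_le_add ?_ ?_)
      · rw [norm_mul, norm_mul, hℓn, Complex.norm_ofNat]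
        gcongr
      · rw [norm_mul, Complex.norm_ofNat]
        gcongr
    rw [norm_mul, norm_pow, hℓn] at h'
    rw [div_mul_eq_mul_div, le_div_iff₀' (by positivity)]
    linarith
  have hA : 0 ≤ A := by positivity
  have hB : 0 ≤ B := by positivity
  set I := ∫ t in (l - ℓ)..l, ‖sol z p q t‖ ^ 2
  -- Cauchy-Schwarz, from the variance of the norm on `[l - ℓ, l]`
  have hN : N ^ 2 ≤ ℓ * I := by
    have h0 : 0 ≤ ∫ t in (l - ℓ)..l, (‖sol z p q t‖ - N / ℓ) ^ 2 :=
      intervalIntegral.integral_nonneg (by linarith) fun _ _ => sq_nonneg _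
    have h1 : ∫ t in (l - ℓ)..l, (‖sol z p q t‖ - N / ℓ) ^ 2 =
        I - 2 * (N / ℓ) * N + ℓ * (N / ℓ) ^ 2 := by
      have : ∀ t, (‖sol z p q t‖ - N / ℓ) ^ 2 =
          ‖sol z p q t‖ ^ 2 - 2 * (N / ℓ) * ‖sol z p q t‖ + (N / ℓ) ^ 2 := fun t => by ring
      simp only [this]
      rw [intervalIntegral.integral_add (Continuous.intervalIntegrable (by fun_prop) _ _)
          (Continuous.intervalIntegrable (by fun_prop) _ _),
        intervalIntegral.integral_sub (Continuous.intervalIntegrable (by fun_prop) _ _)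
          (Continuous.intervalIntegrable (by fun_prop) _ _),
        intervalIntegral.integral_const_mul, intervalIntegral.integral_const]
      simp [I, N]
    rw [h1] at h0
    have h2 : ℓ * (I - 2 * (N / ℓ) * N + ℓ * (N / ℓ) ^ 2) = ℓ * I - N ^ 2 := by
      field_simp
      ring
    have h3 := mul_nonneg hℓ.le h0
    linarith
  have hI : I ≤ ∫ t in (0 : ℝ)..l, ‖sol z p q t‖ ^ 2 :=
    intervalIntegral.integral_mono_interval (by linarith) (by linarith) le_rfl
      (ae_of_all _ fun _ => by positivity) (Continuous.intervalIntegrable (by fun_prop) _ _)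
  calc |current a b| ≤ ‖starRingEnd ℂ a * b‖ := Complex.abs_im_le_norm _
    _ = ‖a‖ * ‖b‖ := by rw [norm_mul, RCLike.norm_conj]
    _ ≤ (A * N) * (B * N) := mul_le_mul ha hb (norm_nonneg _) (by positivity)
    _ = A * B * N ^ 2 := by ring
    _ ≤ A * B * (ℓ * ∫ t in (0 : ℝ)..l, ‖sol z p q t‖ ^ 2) := by
        refine mul_le_mul_of_nonneg_left (hN.trans ?_) (mul_nonneg hA hB)
        exact mul_le_mul_of_nonneg_left hI hℓ.le
    _ = _ := by ring

/-- The currents through the successive generations decrease, and if the edge lengths are bounded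
below they tend to zero. -/
theorem noInflow_of_le_length {z : ℂ} (hz : 0 < z.im) {ℓ : ℝ} (hℓ : 0 < ℓ)
    (hL : ∀ e, ℓ ≤ T.length e) : T.NoInflow z := fun e P Q h => by
  have hz0 := ne_zero_of_im_pos hz
  obtain ⟨C, hC⟩ := exists_abs_current_le hz0 hℓ
  let F : TreeEdge K → ℝ := fun f =>
    current (sol z (P f) (Q f) (T.length f)) (dsol z (P f) (Q f) (T.length f))
  have hstep : ∀ w, ∑ k, F (k :: (w ++ e)) ≤ F (w ++ e) := fun w => by
    have h1 : F (w ++ e) = ∑ k, current (P (k :: (w ++ e))) (Q (k :: (w ++ e))) := by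
      simp only [F, ← h.flux, h.value, current, Finset.mul_sum, Complex.im_sum]
    rw [h1]
    refine Finset.sum_le_sum fun k _ => ?_
    have h2 := current_sub hz0 (P (k :: (w ++ e))) (Q (k :: (w ++ e))) 0 (T.length (k :: (w ++ e)))
    rw [sol_zero, dsol_zero] at h2
    have h3 := mul_nonneg hz.le (energy_nonneg (T := T) z P Q (k :: (w ++ e)))
    simp only [F]
    simp only [energy] at h3
    linarith
  have hF : ∀ n, genSum F e n ≤ F e := fun n => by
    induction n with
    | zero => exact (genSum_zero _ _).le
    | succ n ih =>
      rw [genSum_succ]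
      exact (genSum_mono hstep n).trans ih
  have hE : Filter.Tendsto (fun n => -(C * genSum (T.energy z P Q) e n)) Filter.atTop
      (nhds (-(C * 0))) :=
    ((((summable_iff_genSum (fun f => energy_nonneg z P Q f) e).1 h.summable).tendsto_atTop_zero
      ).const_mul C).neg
  rw [mul_zero, neg_zero] at hE
  refine le_of_tendsto hE (Filter.Eventually.of_forall fun n => le_trans ?_ (hF n))
  simp only [genSum, Finset.mul_sum, ← Finset.sum_neg_distrib]
  exact Finset.sum_le_sum fun v _ => (abs_le.1 (hC _ _ _ (hL _))).1

/-! ### Self-adjoint Laplacian -/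

theorem norm_sq_toLp {μ : Measure ℝ} {f : ℝ → ℂ} (hf : MemLp f 2 μ) :
    ‖hf.toLp‖ ^ 2 = ∫ t, ‖f t‖ ^ 2 ∂μ := by
  have h := inner_self_eq_norm_sq (𝕜 := ℂ) hf.toLp
  rw [← h, L2.inner_def]
  have h1 : ∫ a, inner ℂ ((hf.toLp : Lp ℂ 2 μ) a) ((hf.toLp : Lp ℂ 2 μ) a) ∂μ =
      ∫ a, ((‖f a‖ ^ 2 : ℝ) : ℂ) ∂μ := integral_congr_ae <| by
    filter_upwards [hf.coeFn_toLp] with a ha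
    rw [ha, inner_self_eq_norm_sq_to_K]
    simp
  rw [h1, integral_complex_ofReal]
  simp

/-- The element of `L²(T)` given by a square-integrable function. -/
noncomputable def toL2 {φ : TreeEdge K → ℝ → ℂ} (hφ : IsL2On T.whole φ) : T.L2 :=
  ⟨fun e => (hφ.1 e).toLp, memℓp_gen <| by
    refine hφ.2.congr fun e => ?_
    rw [ENNReal.toReal_ofNat, Real.rpow_ofNat]
    exact (norm_sq_toLp (hφ.1 e)).symm⟩

theorem coeFn_toL2 {φ : TreeEdge K → ℝ → ℂ} (hφ : IsL2On T.whole φ) (e : TreeEdge K) :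
    ((toL2 hφ e : Lp ℂ 2 (volume.restrict (T.whole e))) : ℝ → ℂ)
      =ᵐ[volume.restrict (T.whole e)] φ e :=
  (hφ.1 e).coeFn_toLp

theorem toL2_mem_laplacianGraph {α : ℝ} {φ η : TreeEdge K → ℝ → ℂ} (hφ : IsL2On T.whole φ)
    (hη : IsL2On T.whole η) (h2 : IsH2On T.whole φ fun e s => -η e s)
    (hk : T.Kirchhoff T.whole φ) (hr : RootCondition T.whole α φ) :
    (toL2 hφ, toL2 hη) ∈ T.laplacianGraph α := by
  refine ⟨φ, coeFn_toL2 hφ, h2.congr (fun e => ⟨_, _, rfl⟩) fun e => ?_, hk, hr⟩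
  filter_upwards [coeFn_toL2 hη e] with s hs
  rw [hs]

/-- The second derivative of a function in `H²` is determined by its class in `L²`, so that
`laplacianGraph` is the graph of an operator and `toLinearPMap` takes no junk value. -/
theorem laplacianGraph_functional (α : ℝ) (p : T.L2 × T.L2) (hp : p ∈ T.laplacianGraph α)
    (h0 : p.1 = 0) : p.2 = 0 := by
  obtain ⟨ψ, hψ, h2, -, -⟩ := hp
  refine lp.ext (funext fun e => ?_)
  have hL := T.length_pos e
  have hψ0 : EqOn (ψ e) 0 (Icc 0 (T.length e)) := by
    refine Measure.eqOn_Icc_of_ae_eq volume hL.ne ?_ (h2.differentiableOn e).continuousOn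
      continuousOn_const
    have h1 : (p.1 e : ℝ → ℂ) =ᵐ[volume.restrict (T.whole e)] 0 := by
      rw [h0]
      exact Lp.coeFn_zero ..
    exact (hψ e).symm.trans h1
  have hd : ∀ s ∈ T.whole e, edgeDeriv T.whole ψ e s = 0 := fun s hs => by
    exact (derivWithin_congr hψ0 (hψ0 hs)).trans (by simp)
  have hη := h2.integral_eq e
  have hmem : MemLp (fun s => -(p.2 e : ℝ → ℂ) s) 2 (volume.restrict (Icc 0 (T.length e))) :=
    h2.memLp e
  have hint : IntervalIntegrable (fun s => -(p.2 e : ℝ → ℂ) s) volume 0 (T.length e) :=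
    (intervalIntegrable_iff_integrableOn_Icc_of_le hL.le).2
      (hmem.integrable (by norm_num))
  have hae : ∀ᵐ x, x ∈ Ioo 0 (T.length e) → (p.2 e : ℝ → ℂ) x = 0 := by
    filter_upwards [hint.ae_hasDerivAt_integral] with x hx hx'
    have h1 := hx (by rw [uIcc_of_le hL.le]; exact Ioo_subset_Icc_self hx') 0 left_mem_uIcc
    have h3 : (fun x => ∫ t in (0 : ℝ)..x, -(p.2 e : ℝ → ℂ) t) =ᶠ[nhds x] fun _ => 0 := by
      filter_upwards [Icc_mem_nhds hx'.1 hx'.2] with y hy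
      rw [← hη 0 ⟨le_rfl, hL.le⟩ y hy, hd y hy, hd 0 ⟨le_rfl, hL.le⟩, sub_zero]
    have h4 := (h1.congr_of_eventuallyEq h3.symm).unique (hasDerivAt_const x (0 : ℂ))
    exact neg_eq_zero.1 h4
  have hrestrict : ∀ f : ℝ → ℂ, (∀ᵐ x, x ∈ Ioo 0 (T.length e) → f x = 0) →
      f =ᵐ[volume.restrict (T.whole e)] 0 := fun f hf => by
    rw [show volume.restrict (T.whole e) = volume.restrict (Ioo 0 (T.length e)) from
      (Measure.restrict_congr_set Ioo_ae_eq_Icc).symm]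
    exact (ae_restrict_iff' measurableSet_Ioo).2 hf
  exact Lp.ext ((hrestrict _ hae).trans (Lp.coeFn_zero ..).symm)

theorem im_inner_eq_zero {α : ℝ} (hA : IsSelfAdjoint (T.laplacian α)) {p : T.L2 × T.L2}
    (hp : p ∈ T.laplacianGraph α) : (inner ℂ p.1 p.2).im = 0 := by
  have hg : p ∈ (T.laplacian α).graph := by
    rw [laplacian,
      Submodule.toLinearPMap_graph_eq _ fun x hx h => laplacianGraph_functional α x hx h]
    exact hp
  obtain ⟨y, h1, h2⟩ := (LinearPMap.mem_graph_iff _).1 hg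
  have h3 := LinearPMap.adjoint_isFormalAdjoint hA.dense_domain
  rw [LinearPMap.isSelfAdjoint_def.1 hA] at h3
  have h4 := h3 y y
  rw [h1, h2, ← inner_conj_symm] at h4
  exact Complex.conj_eq_iff_im.1 h4

/-- Green's identity for functions in the domain of a self-adjoint Laplacian. -/
theorem hasSum_im_integral {α : ℝ} (hA : IsSelfAdjoint (T.laplacian α))
    {φ η : TreeEdge K → ℝ → ℂ} (hφ : IsL2On T.whole φ)
    (hη : IsL2On T.whole η) (h2 : IsH2On T.whole φ fun e s => -η e s)
    (hk : T.Kirchhoff T.whole φ) (hr : RootCondition T.whole α φ) :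
    HasSum (fun e => (∫ s in T.whole e, starRingEnd ℂ (φ e s) * η e s).im) 0 := by
  have h := Complex.hasSum_im (lp.hasSum_inner (𝕜 := ℂ) (toL2 hφ) (toL2 hη))
  rw [im_inner_eq_zero hA (toL2_mem_laplacianGraph hφ hη h2 hk hr)] at h
  refine h.congr_fun fun e => ?_
  rw [L2.inner_def]
  congr 1
  refine integral_congr_ae ?_
  filter_upwards [coeFn_toL2 hφ e, coeFn_toL2 hη e] with s h1 h2
  rw [h1, h2, RCLike.inner_apply, mul_comm]

theorem isL2On_whole {φ : TreeEdge K → ℝ → ℂ} (hφ : ∀ f, Continuous (φ f))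
    (hs : Summable fun f => ∫ s in (0 : ℝ)..T.length f, ‖φ f s‖ ^ 2) : IsL2On T.whole φ := by
  refine ⟨fun f => ?_, hs.congr fun f => ?_⟩
  · obtain ⟨C, hC⟩ := isCompact_Icc.exists_bound_of_continuousOn
      (hφ f).continuousOn (s := Icc 0 (T.length f))
    have : MemLp (φ f) 2 (volume.restrict (Icc 0 (T.length f))) :=
      MemLp.of_bound (hφ f).aestronglyMeasurable C
        ((ae_restrict_iff' measurableSet_Icc).2 (ae_of_all _ hC))
    exact this
  · rw [intervalIntegral.integral_of_le (T.length_pos f).le, whole, integral_Icc_eq_integral_Ioc]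

/-- Testing the symmetry of the Laplacian with the given solution, continued to the first edge by a
cubic polynomial which vanishes to second order at the initial point of that edge, expresses the
current as `Im z` times the square norm of the solution on the further edges. -/
theorem noInflow_of_isSelfAdjoint {z : ℂ} (hz : 0 < z.im) {α : ℝ}
    (hA : IsSelfAdjoint (T.laplacian α)) : T.NoInflow z := fun e P Q h => by
  classical
  have hz0 := ne_zero_of_im_pos hz
  have hL := T.length_pos e
  have hLc : (T.length e : ℂ) ≠ 0 := by exact_mod_cast hL.ne'
  set a := sol z (P e) (Q e) (T.length e) with ha
  set b := dsol z (P e) (Q e) (T.length e) with hb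
  -- the cubic `t² (A + B t)` with Cauchy data `(a, b)` at the far end of `e`
  set A : ℂ := 3 * a / T.length e ^ 2 - b / T.length e with hAdef
  set B : ℂ := b / T.length e ^ 2 - 2 * a / T.length e ^ 3 with hBdef
  let w : ℝ → ℂ := fun t => A * t ^ 2 + B * t ^ 3
  let w' : ℝ → ℂ := fun t => 2 * A * t + 3 * B * t ^ 2
  let w'' : ℝ → ℂ := fun t => 2 * A + 6 * B * t
  have hid : ∀ t : ℝ, HasDerivAt (fun t : ℝ => (t : ℂ)) 1 t := fun t =>
    (hasDerivAt_id t).ofReal_comp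
  have hw : ∀ t, HasDerivAt w (w' t) t := fun t =>
    ((((hid t).fun_pow 2).const_mul A).add (((hid t).fun_pow 3).const_mul B)).congr_deriv (by
      simp [w']; ring)
  have hw' : ∀ t, HasDerivAt w' (w'' t) t := fun t =>
    (((hid t).const_mul (2 * A)).add (((hid t).fun_pow 2).const_mul (3 * B))).congr_deriv (by
      simp [w'']; ring)
  have hwL : w (T.length e) = a := by
    simp only [w, hAdef, hBdef]
    field_simp
    ring
  have hwL' : w' (T.length e) = b := by
    simp only [w', hAdef, hBdef]
    field_simp
    ring
  have hw0 : w 0 = 0 := by simp [w]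
  have hw0' : w' 0 = 0 := by simp [w']
  -- `glue u v` is `v` on `e`, `u` on the edges after `e`, and zero on all others
  let glue : (TreeEdge K → ℝ → ℂ) → (ℝ → ℂ) → TreeEdge K → ℝ → ℂ := fun u v f =>
    if f = e then v else if e <:+ f then u f else 0
  have glue_self : ∀ u v, glue u v e = v := fun u v => by simp [glue]
  have glue_of : ∀ u v f, f ≠ e → e <:+ f → glue u v f = u f := fun u v f h1 h2 => by
    simp [glue, h1, h2]
  have glue_not : ∀ u v f, ¬ e <:+ f → glue u v f = 0 := fun u v f h2 => by
    have : f ≠ e := fun h => h2 (h ▸ List.suffix_refl _)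
    simp [glue, this, h2]
  have glue_cases : ∀ f : TreeEdge K, f = e ∨ (f ≠ e ∧ e <:+ f) ∨ ¬ e <:+ f := fun f => by tauto
  let φ := glue (fun f => sol z (P f) (Q f)) w
  let φ' := glue (fun f => dsol z (P f) (Q f)) w'
  let η := glue (fun f t => z * sol z (P f) (Q f) t) (fun t => -w'' t)
  have hφ : ∀ f t, HasDerivAt (φ f) (φ' f t) t := fun f t => by
    rcases glue_cases f with rfl | ⟨h1, h2⟩ | h2
    · simpa only [φ, φ', glue_self] using hw t
    · simpa only [φ, φ', glue_of _ _ f h1 h2] using hasDerivAt_sol hz0 _ _ t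
    · rw [show φ f = 0 by simp only [φ, glue_not _ _ f h2],
        show φ' f = 0 by simp only [φ', glue_not _ _ f h2]]
      exact hasDerivAt_const t (0 : ℂ)
  have hφ' : ∀ f t, HasDerivAt (φ' f) (-η f t) t := fun f t => by
    rcases glue_cases f with rfl | ⟨h1, h2⟩ | h2
    · simpa only [η, φ', glue_self, neg_neg] using hw' t
    · simpa only [η, φ', glue_of _ _ f h1 h2] using hasDerivAt_dsol hz0 _ _ t
    · rw [show φ' f = 0 by simp only [φ', glue_not _ _ f h2],
        show η f = 0 by simp only [η, glue_not _ _ f h2],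
        Pi.zero_apply, neg_zero]
      exact hasDerivAt_const t (0 : ℂ)
  have hφc : ∀ f, Continuous (φ f) := fun f =>
    continuous_iff_continuousAt.2 fun t => (hφ f t).continuousAt
  have hηc : ∀ f, Continuous (η f) := fun f => by
    rcases glue_cases f with rfl | ⟨h1, h2⟩ | h2
    · simp only [η, glue_self, w'']
      fun_prop
    · simp only [η, glue_of _ _ f h1 h2]
      exact continuous_const.mul (continuous_sol hz0 _ _)
    · simp only [η, glue_not _ _ f h2]
      exact continuous_const
  have hdφ : ∀ f, ∀ t ∈ T.whole f, edgeDeriv T.whole φ f t = φ' f t := fun f t ht =>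
    (hφ f t).hasDerivWithinAt.derivWithin (uniqueDiffOn_Icc (T.length_pos f) t ht)
  have hmem0 : ∀ f, (0 : ℝ) ∈ T.whole f := fun f => ⟨le_rfl, (T.length_pos f).le⟩
  have hmemL : ∀ f, T.length f ∈ T.whole f := fun f => ⟨(T.length_pos f).le, le_rfl⟩
  have hsummable : ∀ g : TreeEdge K → ℝ → ℂ, (∀ f, ¬ e <:+ f → g f = 0) →
      (∃ c : ℂ, ∀ f, f ≠ e → e <:+ f → ∀ t, g f t = c * sol z (P f) (Q f) t) →
      Summable fun f => ∫ s in (0 : ℝ)..T.length f, ‖g f s‖ ^ 2 := by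
    rintro g hg0 ⟨c, hc⟩
    refine ((List.append_left_injective e).summable_iff fun f hf => ?_).1 ?_
    · rw [hg0 f fun ⟨v, hv⟩ => hf ⟨v, hv⟩]
      simp
    · refine (h.summable.mul_left (‖c‖ ^ 2)).congr_cofinite ?_
      refine (Set.finite_singleton []).subset fun v hv => ?_
      by_contra hne
      refine hv ?_
      have h1 : v ++ e ≠ e := fun h => hne (by simpa using h)
      change ‖c‖ ^ 2 * T.energy z P Q (v ++ e) =
        ∫ s in (0 : ℝ)..T.length (v ++ e), ‖g (v ++ e) s‖ ^ 2
      simp only [hc _ h1 (List.suffix_append v e), norm_mul, mul_pow,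
        intervalIntegral.integral_const_mul, energy]
  have hφ2 : IsL2On T.whole φ := isL2On_whole hφc <| hsummable φ (glue_not _ _)
    ⟨1, fun f h1 h2 t => by simp only [φ, glue_of _ _ f h1 h2, one_mul]⟩
  have hη2 : IsL2On T.whole η := isL2On_whole hηc <| hsummable η (glue_not _ _)
    ⟨z, fun f h1 h2 t => by simp only [η, glue_of _ _ f h1 h2]⟩
  have hH2 : IsH2On T.whole φ fun f s => -η f s := by
    refine ⟨fun f => (hη2.1 f).neg, fun f t _ => (hφ f t).differentiableAt.differentiableWithinAt,
      fun f s hs t ht => ?_⟩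
    rw [hdφ f s hs, hdφ f t ht]
    exact (intervalIntegral.integral_eq_sub_of_hasDerivAt (fun t _ => hφ' f t)
      ((hηc f).neg.intervalIntegrable _ _)).symm
  have hkey : ∀ f, (∀ k : Fin K, φ (k :: f) 0 = φ f (T.length f)) ∧
      φ' f (T.length f) = ∑ k : Fin K, φ' (k :: f) 0 := fun f => by
    by_cases hf : e <:+ f
    · obtain ⟨v, rfl⟩ := hf
      have hv := h.value v
      have hv' := h.flux v
      have h1 : ∀ k : Fin K, k :: (v ++ e) ≠ e := fun k h => by
        have := congrArg List.length h
        simp at this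
        omega
      have h2 : ∀ k : Fin K, e <:+ k :: (v ++ e) := fun k => List.suffix_append (k :: v) e
      simp only [φ, φ', fun u v k => glue_of u v _ (h1 k) (h2 k), sol_zero, dsol_zero, hv, hv']
      by_cases h3 : v = []
      · subst h3
        simp only [List.nil_append, glue_self]
        exact ⟨fun _ => hwL.symm, hwL'⟩
      · have h4 : v ++ e ≠ e := fun h => h3 (by simpa using h)
        simp only [fun u x => glue_of u x _ h4 (List.suffix_append v e), implies_true, true_and]
    · have hz : ∀ k : Fin K, φ (k :: f) 0 = 0 ∧ φ' (k :: f) 0 = 0 := fun k => by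
        by_cases h1 : k :: f = e
        · rw [h1]
          simp only [φ, φ', glue_self, hw0, hw0', and_self]
        · have h2 : ¬ e <:+ k :: f := fun h2 => by
            rcases List.suffix_cons_iff.1 h2 with h3 | h3
            · exact h1 h3.symm
            · exact hf h3
          simp only [φ, φ', glue_not _ _ _ h2, Pi.zero_apply, and_self]
      have hz' : ∀ t, φ f t = 0 ∧ φ' f t = 0 := fun t => by
        simp only [φ, φ', glue_not _ _ _ hf, Pi.zero_apply, and_self]
      exact ⟨fun k => (hz k).1.trans (hz' _).1.symm, by
        rw [(hz' _).2, Finset.sum_eq_zero fun k _ => (hz k).2]⟩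
  have hk : T.Kirchhoff T.whole φ := fun f _ _ => by
    refine ⟨(hkey f).1, ?_⟩
    rw [hdφ f _ (hmemL f), (hkey f).2]
    exact Finset.sum_congr rfl fun k _ => (hdφ _ _ (hmem0 _)).symm
  have hr : RootCondition T.whole α φ := by
    have h0 : φ [] 0 = 0 ∧ φ' [] 0 = 0 := by
      by_cases h1 : [] = e
      · rw [h1]
        simp only [φ, φ', glue_self, hw0, hw0', and_self]
      · have h2 : ¬ e <:+ [] := fun h2 => h1 (List.suffix_nil.1 h2).symm
        simp only [φ, φ', glue_not _ _ _ h2, Pi.zero_apply, and_self]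
    rw [RootCondition, hdφ _ _ (hmem0 _), h0.1, h0.2]
    simp
  have hsum := hasSum_im_integral hA hφ2 hη2 hH2 hk hr
  have hterm : ∀ f, f ≠ e → 0 ≤ (∫ s in T.whole f, starRingEnd ℂ (φ f s) * η f s).im :=
    fun f hf => by
    by_cases h2 : e <:+ f
    · have h3 : ∀ s, starRingEnd ℂ (φ f s) * η f s = z * ((‖sol z (P f) (Q f) s‖ ^ 2 : ℝ) : ℂ) :=
        fun s => by
        simp only [φ, η, glue_of _ _ f hf h2]
        push_cast
        rw [← Complex.conj_mul']
        ring
      simp only [h3, integral_const_mul]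
      rw [integral_complex_ofReal, Complex.im_mul_ofReal]
      exact mul_nonneg hz.le (integral_nonneg fun _ => by positivity)
    · simp [φ, glue_not _ _ f h2]
  have hfirst : (∫ s in T.whole e, starRingEnd ℂ (φ e s) * η e s).im = -current a b := by
    have hd : ∀ t, HasDerivAt (fun t => starRingEnd ℂ (w t) * w' t)
        (starRingEnd ℂ (w' t) * w' t + starRingEnd ℂ (w t) * w'' t) t := fun t =>
      (hw t).star.mul (hw' t)
    have hd' := fun t => Complex.imCLM.hasFDerivAt.comp_hasDerivAt t (hd t)
    have him : ∀ t, (starRingEnd ℂ (w' t) * w' t + starRingEnd ℂ (w t) * w'' t).im =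
        (starRingEnd ℂ (w t) * w'' t).im := fun t => by
      rw [Complex.add_im, Complex.conj_mul']
      norm_cast
      simp
    have hwc : Continuous w := continuous_iff_continuousAt.2 fun t => (hw t).continuousAt
    have hcont : Continuous fun t => starRingEnd ℂ (w t) * w'' t :=
      (Complex.continuous_conj.comp hwc).mul (by simp only [w'']; fun_prop)
    have hint := intervalIntegral.integral_eq_sub_of_hasDerivAt (a := 0) (b := T.length e)
      (f' := fun t => (starRingEnd ℂ (w t) * w'' t).im)
      (fun t _ => (hd' t).congr_deriv (him t))
      ((Complex.continuous_im.comp hcont).intervalIntegrable _ _)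
    have h4 : ∫ t in (0 : ℝ)..T.length e, (starRingEnd ℂ (w t) * w'' t).im = current a b := by
      rw [hint]
      simp [hwL, hwL', hw0, current]
    have h5 : Integrable (fun s => starRingEnd ℂ (φ e s) * η e s)
        (volume.restrict (T.whole e)) :=
      ((Complex.continuous_conj.comp (hφc e)).mul (hηc e)).continuousOn.integrableOn_Icc
    have h6 := integral_im h5
    simp only [RCLike.im_to_complex] at h6
    rw [← h6, ← h4, whole, integral_Icc_eq_integral_Ioc,
      ← intervalIntegral.integral_of_le hL.le, ← intervalIntegral.integral_neg]
    simp only [φ, η, glue_self, mul_neg, Complex.neg_im]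
  have := le_hasSum hsum e fun f hf => hterm f hf
  rw [hfirst] at this
  linarith

/-! ### Cauchy data of solutions on the cut trees -/

theorem plus_self (u : T.Point) : T.plus u u.edge = Icc u.coord (T.length u.edge) := by
  simp [plus]

theorem plus_of_suffix {u : T.Point} {e : TreeEdge K} (h : e ≠ u.edge) (h' : u.edge <:+ e) :
    T.plus u e = Icc 0 (T.length e) := by
  simp [plus, h, h']

theorem plus_of_not_suffix {u : T.Point} {e : TreeEdge K} (h : ¬ u.edge <:+ e) :
    T.plus u e = ∅ := by
  have : e ≠ u.edge := fun h' => h (h' ▸ List.suffix_refl _)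
  simp [plus, h, this]

theorem minus_self (u : T.Point) : T.minus u u.edge = Icc 0 u.coord := by
  simp [minus]

theorem minus_of_suffix {u : T.Point} {e : TreeEdge K} (h : e ≠ u.edge) (h' : u.edge <:+ e) :
    T.minus u e = ∅ := by
  simp [minus, h, h']

theorem minus_of_not_suffix {u : T.Point} {e : TreeEdge K} (h : ¬ u.edge <:+ e) :
    T.minus u e = Icc 0 (T.length e) := by
  have : e ≠ u.edge := fun h' => h (h' ▸ List.suffix_refl _)
  simp [minus, h, this]

theorem plus_eq_Icc {u : T.Point} (hu : u.coord < T.length u.edge) (e : TreeEdge K) :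
    T.plus u e = ∅ ∨ ∃ a b, a < b ∧ T.plus u e = Icc a b := by
  by_cases h : e = u.edge
  · subst h
    exact Or.inr ⟨_, _, hu, plus_self u⟩
  · by_cases h' : u.edge <:+ e
    · exact Or.inr ⟨_, _, T.length_pos e, plus_of_suffix h h'⟩
    · exact Or.inl (plus_of_not_suffix h')

theorem minus_eq_Icc {u : T.Point} (hu : 0 < u.coord) (e : TreeEdge K) :
    T.minus u e = ∅ ∨ ∃ a b, a < b ∧ T.minus u e = Icc a b := by
  by_cases h : e = u.edge
  · subst h
    exact Or.inr ⟨_, _, hu, minus_self u⟩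
  · by_cases h' : u.edge <:+ e
    · exact Or.inl (minus_of_suffix h h')
    · exact Or.inr ⟨_, _, T.length_pos e, minus_of_not_suffix h'⟩

/-- `ψ` is given on the subgraph `G` by the Cauchy data `P`, `Q` at the initial points of the edges
(extended, if `G e` does not begin at the initial point of `e`). -/
def HasData (z : ℂ) (G : TreeEdge K → Set ℝ) (ψ : TreeEdge K → ℝ → ℂ) (P Q : TreeEdge K → ℂ) :
    Prop :=
  ∀ e, ∀ t ∈ G e, ψ e t = sol z (P e) (Q e) t ∧ edgeDeriv G ψ e t = dsol z (P e) (Q e) t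

theorem IsH2On.exists_hasData {z : ℂ} (hz : z ≠ 0) {G : TreeEdge K → Set ℝ}
    {ψ : TreeEdge K → ℝ → ℂ} (hG : ∀ e, G e = ∅ ∨ ∃ a b, a < b ∧ G e = Icc a b)
    (h : IsH2On G ψ (fun e s => -(z * ψ e s))) : ∃ P Q, HasData z G ψ P Q := by
  have : ∀ e, ∃ p q, ∀ t ∈ G e, ψ e t = sol z p q t ∧ edgeDeriv G ψ e t = dsol z p q t := by
    intro e
    rcases hG e with he | ⟨a, b, hab, he⟩
    · exact ⟨0, 0, fun t ht => by simp [he] at ht⟩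
    · obtain ⟨p, q, hpq⟩ := h.exists_sol hz hab he
      exact ⟨p, q, fun t ht => hpq t (he ▸ ht)⟩
  choose P Q hPQ using this
  exact ⟨P, Q, hPQ⟩

theorem hasData_sol {z : ℂ} (hz : z ≠ 0) {G : TreeEdge K → Set ℝ}
    (hG : ∀ e, G e = ∅ ∨ ∃ a b, a < b ∧ G e = Icc a b) (P Q : TreeEdge K → ℂ) :
    HasData z G (fun e => sol z (P e) (Q e)) P Q := fun e t ht => by
  rcases hG e with he | ⟨a, b, hab, he⟩
  · simp [he] at ht
  · exact ⟨rfl, edgeDeriv_sol hz P Q hab he ht⟩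

theorem setIntegral_Icc_zero_length (f : ℝ → ℝ) (e : TreeEdge K) :
    ∫ t in Icc 0 (T.length e), f t = ∫ t in (0 : ℝ)..T.length e, f t := by
  rw [intervalIntegral.integral_of_le (T.length_pos e).le, integral_Icc_eq_integral_Ioc]

theorem HasData.setIntegral {z : ℂ} {G : TreeEdge K → Set ℝ} {ψ : TreeEdge K → ℝ → ℂ}
    {P Q : TreeEdge K → ℂ} (h : HasData z G ψ P Q) {e : TreeEdge K}
    (he : G e = Icc 0 (T.length e)) : ∫ t in G e, ‖ψ e t‖ ^ 2 = T.energy z P Q e := by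
  rw [he, setIntegral_congr_fun measurableSet_Icc (g := fun t => ‖sol z (P e) (Q e) t‖ ^ 2)
    (fun t ht => by simp only [(h e t (he ▸ ht)).1]), setIntegral_Icc_zero_length, energy]

theorem IsSolutionPlus.exists_isForward {z : ℂ} (hz : z ≠ 0) {u : T.Point}
    (hu : u.coord < T.length u.edge) {ψ : TreeEdge K → ℝ → ℂ} (h : T.IsSolutionPlus z u ψ) :
    ∃ P Q, T.IsForward z u.edge P Q ∧ HasData z (T.plus u) ψ P Q := by
  obtain ⟨P, Q, hPQ⟩ := h.isH2On.exists_hasData hz (plus_eq_Icc hu)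
  have hfull : ∀ w, w ≠ [] → T.plus u (w ++ u.edge) = Icc 0 (T.length (w ++ u.edge)) :=
    fun w hw => plus_of_suffix (fun h => hw (by simpa using h)) (List.suffix_append _ _)
  have h0 : ∀ k w, (0 : ℝ) ∈ T.plus u (k :: (w ++ u.edge)) := fun k w => by
    rw [← List.cons_append, hfull (k :: w) (by simp)]
    exact ⟨le_rfl, (T.length_pos _).le⟩
  have hL : ∀ w, T.length (w ++ u.edge) ∈ T.plus u (w ++ u.edge) := fun w => by
    by_cases hw : w = []
    · subst hw
      rw [List.nil_append, plus_self]
      exact ⟨u.coord_le, le_rfl⟩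
    · rw [hfull w hw]
      exact ⟨(T.length_pos _).le, le_rfl⟩
  refine ⟨P, Q, ⟨fun w k => ?_, fun w => ?_, ?_⟩, hPQ⟩
  · have h1 := (h.kirchhoff (w ++ u.edge) (hL w) fun k => h0 k w).1 k
    rwa [(hPQ _ _ (h0 k w)).1, (hPQ _ _ (hL w)).1, sol_zero] at h1
  · have h1 := (h.kirchhoff (w ++ u.edge) (hL w) fun k => h0 k w).2
    rw [(hPQ _ _ (hL w)).2] at h1
    rw [h1]
    exact Finset.sum_congr rfl fun k _ => by rw [(hPQ _ _ (h0 k w)).2, dsol_zero]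
  · have h1 := h.isL2On.2.comp_injective (List.append_left_injective u.edge)
    refine h1.congr_cofinite ((Set.finite_singleton []).subset fun w hw => ?_)
    by_contra hne
    exact hw (hPQ.setIntegral (hfull w hne))

theorem IsForward.isSolutionPlus {z : ℂ} (hz : z ≠ 0) {u : T.Point}
    (hu : u.coord < T.length u.edge) {P Q : TreeEdge K → ℂ} (h : T.IsForward z u.edge P Q) :
    T.IsSolutionPlus z u (fun e => sol z (P e) (Q e)) := by
  have hG := plus_eq_Icc hu
  have hd := hasData_sol hz hG P Q
  refine ⟨⟨fun e => ?_, ?_⟩, isH2On_sol hz hG P Q, fun e he he' => ?_⟩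
  · rcases hG e with h1 | ⟨a, b, -, h1⟩
    · simp [h1]
    · rw [h1]
      exact memLp_sol hz _ _ a b
  · refine ((List.append_left_injective u.edge).summable_iff fun f hf => ?_).1 ?_
    · rw [plus_of_not_suffix fun ⟨v, hv⟩ => hf ⟨v, hv⟩]
      simp
    · refine h.summable.congr_cofinite ((Set.finite_singleton []).subset fun w hw => ?_)
      by_contra hne
      exact hw (hd.setIntegral (plus_of_suffix (fun h => hne (by simpa using h))
        (List.suffix_append _ _))).symm
  · have hs : u.edge <:+ e := by
      by_contra hs
      simp [plus_of_not_suffix hs] at he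
    obtain ⟨w, rfl⟩ := hs
    refine ⟨fun k => ?_, ?_⟩
    · rw [sol_zero, h.value]
    · rw [(hd _ _ he).2, ← h.flux]
      exact Finset.sum_congr rfl fun k _ => by rw [(hd _ _ (he' k)).2, dsol_zero]

/-! ### Uniqueness on the forward subtrees -/

section

variable {z : ℂ} {R : TreeEdge K → ℂ} (hz : 0 < z.im)
include hz

/-- A square-integrable solution on a forward subtree which vanishes at the initial point vanishes
identically: its current is zero there, so by `current_sub` it vanishes on the first edge, and then
at the initial points of the following edges. -/
theorem NoInflow.eq_zero (hT : T.NoInflow z) {e : TreeEdge K} {P Q : TreeEdge K → ℂ}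
    (h : T.IsForward z e P Q) (h0 : P e = 0) (w : TreeEdge K) :
    P (w ++ e) = 0 ∧ Q (w ++ e) = 0 := by
  have hz0 := ne_zero_of_im_pos hz
  have first : ∀ f, T.IsForward z f P Q → P f = 0 → Q f = 0 := fun f hf hf0 => by
    by_contra hQ
    have h1 := current_sub hz0 (P f) (Q f) 0 (T.length f)
    have h2 := hT f P Q hf
    have h3 := mul_pos hz (integral_sol_pos hz0 (p := P f) (q := Q f) (by tauto) (T.length_pos f))
    rw [sol_zero, dsol_zero] at h1
    have h4 : current (P f) (Q f) = 0 := by simp [hf0, current]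
    linarith
  induction w with
  | nil => exact ⟨h0, first e h h0⟩
  | cons k w ih =>
    have h1 : P (k :: w ++ e) = 0 := by
      rw [List.cons_append, h.value, ih.1, ih.2]
      simp [sol]
    exact ⟨h1, first _ (h.append (k :: w)) h1⟩

theorem NoInflow.exists_smul (hT : T.NoInflow z) (hR : T.IsWeyl z R) {e : TreeEdge K}
    {P Q : TreeEdge K → ℂ} (h : T.IsForward z e P Q) :
    ∃ c : ℂ, ∀ w, P (w ++ e) = c * weylValue T z R (w ++ e) ∧
      Q (w ++ e) = c * (weylValue T z R (w ++ e) * R (w ++ e)) := by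
  refine ⟨P e / weylValue T z R e, fun w => ?_⟩
  have h1 := hT.eq_zero hz (h.sub_smul (ne_zero_of_im_pos hz) (hR.isForward hz e)
    (P e / weylValue T z R e)) (by
      rw [div_mul_cancel₀ _ (hR.weylValue_ne_zero hz e), sub_self]) w
  exact ⟨sub_eq_zero.1 h1.1, sub_eq_zero.1 h1.2⟩

theorem NoInflow.eq_mul (hT : T.NoInflow z) (hR : T.IsWeyl z R) {e : TreeEdge K}
    {P Q : TreeEdge K → ℂ} (h : T.IsForward z e P Q) : Q e = P e * R e := by
  obtain ⟨c, hc⟩ := hT.exists_smul hz hR h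
  have := hc []
  rw [List.nil_append] at this
  rw [this.1, this.2]
  ring

/-- Every square-integrable solution on `T⁺_u` is a multiple of the Weyl solution. -/
theorem IsSolutionPlus.exists_smul (hT : T.NoInflow z) (hR : T.IsWeyl z R) {u : T.Point}
    (hu : u.coord < T.length u.edge) {ψ : TreeEdge K → ℝ → ℂ} (h : T.IsSolutionPlus z u ψ) :
    ∃ c : ℂ, ∀ e, ∀ t ∈ T.plus u e,
      ψ e t = c * weylValue T z R e * sol z 1 (R e) t ∧
      edgeDeriv (T.plus u) ψ e t = c * weylValue T z R e * dsol z 1 (R e) t := by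
  obtain ⟨P, Q, hf, hd⟩ := h.exists_isForward (ne_zero_of_im_pos hz) hu
  obtain ⟨c, hc⟩ := hT.exists_smul hz hR hf
  refine ⟨c, fun e t ht => ?_⟩
  have hs : u.edge <:+ e := by
    by_contra hs
    simp [plus_of_not_suffix hs] at ht
  obtain ⟨w, rfl⟩ := hs
  rw [(hd _ t ht).1, (hd _ t ht).2, (hc w).1, (hc w).2, ← mul_assoc, ← sol_smul, ← dsol_smul,
    mul_one]
  exact ⟨rfl, rfl⟩

end

/-! ### Solutions on the backward subtrees -/

/-- The Cauchy data at the initial point of `e` of the solution which satisfies the condition at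
the root and which is proportional, on each branch leaving the path from the root to `e`, to the
Weyl solution of that branch. By the Kirchhoff condition the derivatives on these branches are
subtracted at each vertex of the path. -/
noncomputable def pathData (T : MetricTree K) (α : ℝ) (z : ℂ) (R : TreeEdge K → ℂ) :
    TreeEdge K → ℂ × ℂ
  | [] => (Real.sin α, Real.cos α)
  | k :: e =>
    (sol z (pathData T α z R e).1 (pathData T α z R e).2 (T.length e),
      dsol z (pathData T α z R e).1 (pathData T α z R e).2 (T.length e) -
        sol z (pathData T α z R e).1 (pathData T α z R e).2 (T.length e) *
          (∑ j, R (j :: e) - R (k :: e)))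

open Classical in
/-- The Cauchy data on all edges of the solution on the tree cut on the edge `e₀`: those of
`pathData` on the path from the root to `e₀`, and those of a multiple of the Weyl solution on the
branches leaving this path. The values on the edges after `e₀` are irrelevant. -/
noncomputable def minusData (T : MetricTree K) (α : ℝ) (z : ℂ) (R : TreeEdge K → ℂ)
    (e₀ : TreeEdge K) : TreeEdge K → ℂ × ℂ
  | [] => pathData T α z R []
  | k :: e =>
    if k :: e <:+ e₀ then pathData T α z R (k :: e) else
    (sol z (minusData T α z R e₀ e).1 (minusData T α z R e₀ e).2 (T.length e),
      sol z (minusData T α z R e₀ e).1 (minusData T α z R e₀ e).2 (T.length e) * R (k :: e))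

section

variable {α : ℝ} {z : ℂ} {R : TreeEdge K → ℂ} {e₀ : TreeEdge K}

theorem minusData_of_suffix {e : TreeEdge K} (h : e <:+ e₀) :
    minusData T α z R e₀ e = pathData T α z R e := by
  cases e with
  | nil => rfl
  | cons k e => simp [minusData, h]

theorem minusData_of_not_suffix {e : TreeEdge K} (h : ¬ e <:+ e₀) :
    (minusData T α z R e₀ e).2 = (minusData T α z R e₀ e).1 * R e := by
  cases e with
  | nil => exact absurd List.nil_suffix h
  | cons k e => simp [minusData, h]

theorem minusData_value (k : Fin K) (e : TreeEdge K) :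
    (minusData T α z R e₀ (k :: e)).1 =
      sol z (minusData T α z R e₀ e).1 (minusData T α z R e₀ e).2 (T.length e) := by
  by_cases h : k :: e <:+ e₀
  · rw [minusData_of_suffix h, minusData_of_suffix ((List.suffix_cons k e).trans h), pathData]
  · simp [minusData, h]

theorem sol_minusData_of_not_suffix {e : TreeEdge K} (h : ¬ e <:+ e₀) (t : ℝ) :
    sol z (minusData T α z R e₀ e).1 (minusData T α z R e₀ e).2 t =
        (minusData T α z R e₀ e).1 * sol z 1 (R e) t ∧
      dsol z (minusData T α z R e₀ e).1 (minusData T α z R e₀ e).2 t =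
        (minusData T α z R e₀ e).1 * dsol z 1 (R e) t := by
  have h4 := dsol_smul z (minusData T α z R e₀ e).1 1 (R e) t
  have h5 := sol_smul z (minusData T α z R e₀ e).1 1 (R e) t
  rw [mul_one, ← minusData_of_not_suffix h] at h4 h5
  exact ⟨h5, h4⟩

theorem exists_cons_suffix {e : TreeEdge K} (h : e <:+ e₀) (hne : e ≠ e₀) :
    ∃ k, k :: e <:+ e₀ := by
  obtain ⟨t, rfl⟩ := h
  rcases List.eq_nil_or_concat t with rfl | ⟨t, k, rfl⟩
  · exact absurd rfl hne
  · exact ⟨k, t, by simp⟩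

theorem cons_suffix_unique {e : TreeEdge K} {j k : Fin K} (hj : j :: e <:+ e₀)
    (hk : k :: e <:+ e₀) : j = k := by
  have := List.suffix_of_suffix_length_le hj hk (by simp)
  have := this.eq_of_length (by simp)
  simpa using this

theorem minusData_flux (hR : T.IsWeyl z R) {e : TreeEdge K} (hne : e ≠ e₀) :
    ∑ k, (minusData T α z R e₀ (k :: e)).2 =
      dsol z (minusData T α z R e₀ e).1 (minusData T α z R e₀ e).2 (T.length e) := by
  by_cases h : e <:+ e₀
  · obtain ⟨k, hk⟩ := exists_cons_suffix h hne
    rw [← Finset.add_sum_erase _ _ (Finset.mem_univ k)]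
    have h1 : ∀ j ∈ Finset.univ.erase k, (minusData T α z R e₀ (j :: e)).2 =
        sol z (pathData T α z R e).1 (pathData T α z R e).2 (T.length e) * R (j :: e) :=
      fun j hj => by
        have : ¬ j :: e <:+ e₀ := fun hj' =>
          Finset.ne_of_mem_erase hj (cons_suffix_unique hj' hk)
        rw [minusData_of_not_suffix this, minusData_value, minusData_of_suffix h]
    rw [Finset.sum_congr rfl h1, ← Finset.mul_sum, minusData_of_suffix hk, minusData_of_suffix h,
      pathData, ← Finset.add_sum_erase _ (fun j => R (j :: e)) (Finset.mem_univ k)]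
    ring
  · have h1 : ∀ k, ¬ k :: e <:+ e₀ := fun k hk => h ((List.suffix_cons k e).trans hk)
    have h2 := minusData_of_not_suffix (T := T) (α := α) (z := z) (R := R) h
    have h3 := hR.riccati e
    have h4 := dsol_smul z (minusData T α z R e₀ e).1 1 (R e) (T.length e)
    have h5 := sol_smul z (minusData T α z R e₀ e).1 1 (R e) (T.length e)
    rw [mul_one, ← h2] at h4 h5
    simp only [minusData_of_not_suffix (h1 _), minusData_value, ← Finset.mul_sum]
    rw [h4, h5, h3]
    ring

section

variable (hz : 0 < z.im) (hR : T.IsWeyl z R)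
include hz hR

/-- Along a path away from the root the current of the backward solution is negative: it vanishes
at the root, decreases on the edges and does not increase at the vertices. -/
theorem current_pathData (e : TreeEdge K) :
    ¬ ((pathData T α z R e).1 = 0 ∧ (pathData T α z R e).2 = 0) ∧
      current (pathData T α z R e).1 (pathData T α z R e).2 ≤ 0 ∧
      (e ≠ [] → current (pathData T α z R e).1 (pathData T α z R e).2 < 0) := by
  have hz0 := ne_zero_of_im_pos hz
  induction e with
  | nil =>
    refine ⟨fun h => ?_, ?_, fun h => absurd rfl h⟩
    · simp only [pathData, Complex.ofReal_eq_zero] at h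
      have := Real.sin_sq_add_cos_sq α
      rw [h.1, h.2] at this
      norm_num at this
    · simp [pathData, current, Complex.conj_ofReal, -Complex.ofReal_sin, -Complex.ofReal_cos]
  | cons k e ih =>
    set p := (pathData T α z R e).1 with hp
    set q := (pathData T α z R e).2 with hq
    have h1 := current_sub hz0 p q 0 (T.length e)
    rw [sol_zero, dsol_zero] at h1
    have h2 := mul_pos hz (integral_sol_pos hz0 ih.1 (T.length_pos e))
    have h3 : 0 ≤ (∑ j, R (j :: e) - R (k :: e)).im := by
      rw [Complex.sub_im, Complex.im_sum, sub_nonneg]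
      exact Finset.single_le_sum (f := fun j => (R (j :: e)).im) (fun j _ => hR.im_nonneg _)
        (Finset.mem_univ k)
    have h4 : current (pathData T α z R (k :: e)).1 (pathData T α z R (k :: e)).2 < 0 := by
      have h5 : current (pathData T α z R (k :: e)).1 (pathData T α z R (k :: e)).2 =
          current (sol z p q (T.length e)) (dsol z p q (T.length e)) -
            (∑ j, R (j :: e) - R (k :: e)).im * ‖sol z p q (T.length e)‖ ^ 2 := by
        rw [← current_mul_self, pathData]
        simp only [current, ← hp, ← hq]
        rw [← Complex.sub_im, ← mul_sub, mul_comm (∑ j, R (j :: e) - R (k :: e))]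
      have h6 := mul_nonneg h3 (sq_nonneg ‖sol z p q (T.length e)‖)
      rw [h5]
      linarith [ih.2.1]
    refine ⟨fun h => ?_, h4.le, fun _ => h4⟩
    rw [h.1, h.2] at h4
    simp [current] at h4

theorem sol_pathData_ne_zero (hα : α ∈ Ico 0 Real.pi) {e : TreeEdge K} {t : ℝ} (ht : 0 ≤ t)
    (hroot : ¬ (e = [] ∧ t = 0 ∧ α = 0)) :
    sol z (pathData T α z R e).1 (pathData T α z R e).2 t ≠ 0 := fun h => by
  obtain ⟨h1, h2, h3⟩ := current_pathData (α := α) hz hR e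
  have h4 := current_sub (ne_zero_of_im_pos hz) (pathData T α z R e).1 (pathData T α z R e).2 0 t
  rw [h, sol_zero, dsol_zero] at h4
  simp only [current, map_zero, zero_mul, Complex.zero_im, sub_zero] at h4 h2 h3
  rcases ht.eq_or_lt with rfl | ht
  · by_cases he : e = []
    · subst he
      simp only [sol_zero, pathData, Complex.ofReal_eq_zero] at h
      have h5 : α ≠ 0 := fun h5 => hroot ⟨rfl, rfl, h5⟩
      exact (Real.sin_pos_of_pos_of_lt_pi (lt_of_le_of_ne hα.1 h5.symm) hα.2).ne' h
    · have := h3 he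
      rw [h4] at this
      simp at this
  · have := mul_pos hz (integral_sol_pos (ne_zero_of_im_pos hz) h1 ht)
    linarith

theorem minusData_ne_zero (hα : α ∈ Ico 0 Real.pi) {e : TreeEdge K} (h : ¬ e <:+ e₀) :
    (minusData T α z R e₀ e).1 ≠ 0 := by
  induction e with
  | nil => exact absurd List.nil_suffix h
  | cons k e ih =>
    rw [minusData_value]
    by_cases he : e <:+ e₀
    · rw [minusData_of_suffix he]
      exact sol_pathData_ne_zero hz hR hα (T.length_pos e).le fun h => (T.length_pos e).ne' h.2.1
    · rw [(sol_minusData_of_not_suffix he _).1]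
      exact mul_ne_zero (ih he) (hR.sol_ne_zero hz le_rfl)

/-- The branches leaving a path are finitely many, whence a common bound for the factors by which
the solution differs from the Weyl solution on them. -/
theorem exists_norm_minusData_le :
    ∃ C : ℝ, ∀ e, ¬ e <:+ e₀ → ‖(minusData T α z R e₀ e).1‖ ≤ C * ‖weylValue T z R e‖ := by
  let β : TreeEdge K → ℝ := fun e => ‖(minusData T α z R e₀ e).1‖ / ‖weylValue T z R e‖
  have hβ : ∀ e, 0 ≤ β e := fun e => by positivity
  have hw : ∀ e, 0 < ‖weylValue T z R e‖ := fun e => norm_pos_iff.2 (hR.weylValue_ne_zero hz e)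
  -- `β` is constant on each branch, and `k :: f` begins a branch if `f` lies on the path
  refine ⟨∑ f ∈ e₀.tails.toFinset, ∑ k, β (k :: f), fun e he => ?_⟩
  rw [← div_le_iff₀ (hw e)]
  change β e ≤ _
  induction e with
  | nil => exact absurd List.nil_suffix he
  | cons k e ih =>
    by_cases h : e <:+ e₀
    · exact (Finset.single_le_sum (f := fun k => β (k :: e)) (fun k _ => hβ _)
        (Finset.mem_univ k)).trans (Finset.single_le_sum (f := fun f => ∑ k, β (k :: f))
          (fun f _ => Finset.sum_nonneg fun k _ => hβ _) (by simpa using h))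
    · refine le_of_eq_of_le ?_ (ih h)
      simp only [β]
      rw [minusData_value, (sol_minusData_of_not_suffix h _).1, weylValue, norm_mul, norm_mul,
        mul_div_mul_right _ _ (norm_ne_zero_iff.2 (hR.sol_ne_zero hz le_rfl))]

theorem isSolutionMinus_minusData (hK : 1 ≤ K) {u : T.Point} (hu : 0 < u.coord) :
    T.IsSolutionMinus α z u (fun e => sol z (minusData T α z R u.edge e).1
      (minusData T α z R u.edge e).2) := by
  have hz0 := ne_zero_of_im_pos hz
  have hG := minus_eq_Icc hu
  have hd := hasData_sol hz0 hG (fun e => (minusData T α z R u.edge e).1)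
    (fun e => (minusData T α z R u.edge e).2)
  have h0 : (0 : ℝ) ∈ T.minus u [] := by
    by_cases h : ([] : TreeEdge K) = u.edge
    · rw [h, minus_self]
      exact ⟨le_rfl, hu.le⟩
    · rw [minus_of_not_suffix fun h' => h (List.suffix_nil.1 h').symm]
      exact ⟨le_rfl, (T.length_pos _).le⟩
  refine ⟨⟨fun e => ?_, ?_⟩, isH2On_sol hz0 hG _ _, fun e he he' => ?_, ?_⟩
  · rcases hG e with h1 | ⟨a, b, -, h1⟩
    · simp [h1]
    · rw [h1]
      exact memLp_sol hz0 _ _ a b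
  · obtain ⟨C, hC⟩ := exists_norm_minusData_le (α := α) (e₀ := u.edge) hz hR
    have hs := (hR.isForward hz []).summable
    simp only [List.append_nil] at hs
    have h1 : ∀ e, ∫ t in T.minus u e, ‖sol z (minusData T α z R u.edge e).1
        (minusData T α z R u.edge e).2 t‖ ^ 2 ≤
        C ^ 2 * T.energy z (weylValue T z R) (fun f => weylValue T z R f * R f) e +
          {f | f <:+ u.edge}.indicator (fun e => ∫ t in T.minus u e,
            ‖sol z (minusData T α z R u.edge e).1 (minusData T α z R u.edge e).2 t‖ ^ 2) e := by
      intro e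
      have hpos : 0 ≤ C ^ 2 * T.energy z (weylValue T z R) (fun f => weylValue T z R f * R f) e :=
        mul_nonneg (sq_nonneg _) (energy_nonneg _ _ _ _)
      by_cases h : e <:+ u.edge
      · rw [indicator_of_mem (show e ∈ {f | f <:+ u.edge} from h)]
        linarith
      · rw [indicator_of_notMem (show e ∉ {f | f <:+ u.edge} from h), add_zero]
        by_cases h' : u.edge <:+ e
        · rw [minus_of_suffix (fun h1 => h (h1 ▸ List.suffix_refl _)) h']
          simpa using hpos
        · rw [minus_of_not_suffix h', setIntegral_Icc_zero_length, energy,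
            ← intervalIntegral.integral_const_mul]
          refine intervalIntegral.integral_mono (T.length_pos e).le
            (((continuous_sol hz0 _ _).norm.pow 2).intervalIntegrable _ _)
            (((((continuous_sol hz0 _ _).norm.pow 2).intervalIntegrable _ _)).const_mul _)
            fun t => ?_
          have h2 := sol_smul z (weylValue T z R e) 1 (R e) t
          rw [mul_one] at h2
          simp only [(sol_minusData_of_not_suffix h t).1, h2, norm_mul, mul_pow]
          have h3 := mul_le_mul_of_nonneg_right (pow_le_pow_left₀ (norm_nonneg _) (hC e h) 2)
            (sq_nonneg ‖sol z 1 (R e) t‖)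
          rw [mul_pow] at h3
          linarith
    have hfin : {f : TreeEdge K | f <:+ u.edge}.Finite :=
      (u.edge.tails.finite_toSet).subset fun f hf => by simpa using hf
    exact Summable.of_nonneg_of_le (fun e => integral_nonneg fun _ => by positivity) h1
      ((hs.mul_left _).add (summable_of_hasFiniteSupport
        (hfin.subset (support_indicator_subset (s := {f : TreeEdge K | f <:+ u.edge})))))
  · have hne : e ≠ u.edge := fun hne => by
      have := he' ⟨0, hK⟩
      rw [minus_of_suffix (by simp [hne])
        (by rw [hne]; exact List.suffix_cons _ _)] at this
      exact this
    refine ⟨fun k => ?_, ?_⟩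
    · rw [sol_zero, minusData_value]
    · rw [(hd _ _ he).2, ← minusData_flux hR hne]
      exact Finset.sum_congr rfl fun k _ => by rw [(hd _ _ (he' k)).2, dsol_zero]
  · rw [RootCondition, (hd _ _ h0).2, sol_zero, dsol_zero]
    simp only [minusData, pathData]
    ring

/-- Every square-integrable solution on `T⁻_u` satisfying the condition at the root is a multiple
of the one given by `minusData`. -/
theorem IsSolutionMinus.exists_smul (hT : T.NoInflow z) {u : T.Point} (hu : 0 < u.coord)
    {ψ : TreeEdge K → ℝ → ℂ} (h : T.IsSolutionMinus α z u ψ) :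
    ∃ c : ℂ, ∀ e, ∀ t ∈ T.minus u e,
      ψ e t = c * sol z (minusData T α z R u.edge e).1 (minusData T α z R u.edge e).2 t ∧
      edgeDeriv (T.minus u) ψ e t =
        c * dsol z (minusData T α z R u.edge e).1 (minusData T α z R u.edge e).2 t := by
  have hz0 := ne_zero_of_im_pos hz
  obtain ⟨P, Q, hd⟩ := h.isH2On.exists_hasData hz0 (minus_eq_Icc hu)
  have h0 : ∀ e, (u.edge <:+ e → e = u.edge) → (0 : ℝ) ∈ T.minus u e := fun e he => by
    by_cases h : u.edge <:+ e
    · rw [he h, minus_self]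
      exact ⟨le_rfl, hu.le⟩
    · rw [minus_of_not_suffix h]
      exact ⟨le_rfl, (T.length_pos e).le⟩
  have hL : ∀ e, ¬ u.edge <:+ e → T.length e ∈ T.minus u e := fun e he => by
    rw [minus_of_not_suffix he]
    exact ⟨(T.length_pos e).le, le_rfl⟩
  have hchild : ∀ e, ¬ u.edge <:+ e → ∀ k : Fin K, u.edge <:+ k :: e → k :: e = u.edge :=
    fun e he k hk => by
      rcases List.suffix_cons_iff.1 hk with h1 | h1
      · exact h1.symm
      · exact absurd h1 he
  have hvalue : ∀ e, ¬ u.edge <:+ e → ∀ k, P (k :: e) = sol z (P e) (Q e) (T.length e) :=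
    fun e he k => by
      have h1 := (h.kirchhoff e (hL e he) fun k => h0 _ (hchild e he k)).1 k
      rwa [(hd _ _ (h0 _ (hchild e he k))).1, (hd _ _ (hL e he)).1, sol_zero] at h1
  have hflux : ∀ e, ¬ u.edge <:+ e → ∑ k, Q (k :: e) = dsol z (P e) (Q e) (T.length e) :=
    fun e he => by
      have h1 := (h.kirchhoff e (hL e he) fun k => h0 _ (hchild e he k)).2
      rw [(hd _ _ (hL e he)).2] at h1
      rw [h1]
      exact Finset.sum_congr rfl fun k _ => by rw [(hd _ _ (h0 _ (hchild e he k))).2, dsol_zero]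
  -- on a branch leaving the path the solution has the logarithmic derivative of the Weyl solution
  have hbranch : ∀ e, ¬ u.edge <:+ e → ¬ e <:+ u.edge → Q e = P e * R e := fun e he he' => by
    have hw : ∀ w, ¬ u.edge <:+ w ++ e := fun w hw => by
      rcases List.suffix_or_suffix_of_suffix hw (List.suffix_append w e) with h1 | h1
      · exact he h1
      · exact he' h1
    refine hT.eq_mul hz hR ⟨fun w k => hvalue _ (hw w) k, fun w => hflux _ (hw w), ?_⟩
    exact (h.isL2On.2.comp_injective (List.append_left_injective e)).congr fun w =>
      hd.setIntegral (minus_of_not_suffix (hw w))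
  have hroot : (Real.cos α : ℂ) * P [] - (Real.sin α : ℂ) * Q [] = 0 := by
    have h1 := h.rootCondition
    have h2 := h0 [] fun h => (List.suffix_nil.1 h).symm
    rwa [RootCondition, (hd _ _ h2).1, (hd _ _ h2).2, sol_zero, dsol_zero] at h1
  set c : ℂ := Real.sin α * P [] + Real.cos α * Q [] with hc
  have hdata : ∀ e, (u.edge <:+ e → e = u.edge) →
      P e = c * (minusData T α z R u.edge e).1 ∧ Q e = c * (minusData T α z R u.edge e).2 := by
    intro e
    induction e with
    | nil =>
      intro _
      have h1 : (Real.sin α : ℂ) ^ 2 + (Real.cos α : ℂ) ^ 2 = 1 := by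
        exact_mod_cast Real.sin_sq_add_cos_sq α
      simp only [minusData, pathData, hc]
      constructor
      · linear_combination (-P []) * h1 + (Real.cos α : ℂ) * hroot
      · linear_combination (-Q []) * h1 - (Real.sin α : ℂ) * hroot
    | cons k e ih =>
      intro hk
      have he : ¬ u.edge <:+ e := fun he => by
        have h1 := hk (he.trans (List.suffix_cons k e))
        rw [← h1] at he
        have := he.length_le
        simp at this
      obtain ⟨hP, hQ⟩ := ih fun h => absurd h he
      have hPk : ∀ j, P (j :: e) = c * (minusData T α z R u.edge (j :: e)).1 := fun j => by
        rw [hvalue e he, hP, hQ, sol_smul, minusData_value]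
      have hQj : ∀ j, ¬ j :: e <:+ u.edge →
          Q (j :: e) = c * (minusData T α z R u.edge (j :: e)).2 := fun j hj => by
        have h1 : ¬ u.edge <:+ j :: e := fun h1 => hj (hchild e he j h1 ▸ List.suffix_refl _)
        rw [hbranch _ h1 hj, hPk, minusData_of_not_suffix hj, mul_assoc]
      refine ⟨hPk k, ?_⟩
      by_cases hks : k :: e <:+ u.edge
      · have hne : e ≠ u.edge := fun h => he (h ▸ List.suffix_refl _)
        have h1 := hflux e he
        rw [hP, hQ, dsol_smul, ← minusData_flux hR hne, Finset.mul_sum,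
          ← Finset.add_sum_erase _ _ (Finset.mem_univ k),
          ← Finset.add_sum_erase _ _ (Finset.mem_univ k),
          Finset.sum_congr rfl fun j hj => hQj j fun hj' =>
            (Finset.ne_of_mem_erase hj) (cons_suffix_unique hj' hks)] at h1
        exact add_right_cancel h1
      · exact hQj k hks
  refine ⟨c, fun e t ht => ?_⟩
  have he : u.edge <:+ e → e = u.edge := fun he => by
    by_contra hne
    simp [minus_of_suffix hne he] at ht
  rw [(hd _ t ht).1, (hd _ t ht).2, (hdata e he).1, (hdata e he).2, sol_smul, dsol_smul]
  exact ⟨rfl, rfl⟩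

end

end

/-! ### Normalized solutions and their logarithmic derivatives -/

section

variable {z : ℂ} {α : ℝ} {R : TreeEdge K → ℂ}

theorem suffix_of_mem_plus {x : T.Point} {f : TreeEdge K} {t : ℝ} (h : t ∈ T.plus x f) :
    x.edge <:+ f := by
  by_contra hs
  simp [plus_of_not_suffix hs] at h

/-- If `x` lies on `T⁻_u` and `u` does not lie on `T⁺_x`, then `x` and `u` are on different
branches. -/
theorem not_suffix_of_notMem_plus {u x : T.Point} (hx : x.coord ∈ T.minus u x.edge)
    (hu : u.coord ∉ T.plus x u.edge) : ¬ x.edge <:+ u.edge := fun hs => by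
  by_cases he : u.edge = x.edge
  · rw [← he, minus_self] at hx
    rw [he, plus_self] at hu
    exact hu ⟨hx.2, he ▸ u.coord_le⟩
  · rw [plus_of_suffix he hs] at hu
    exact hu ⟨u.coord_nonneg, u.coord_le⟩

theorem mem_plus_self (u : T.Point) : u.coord ∈ T.plus u u.edge := by
  rw [plus_self]
  exact ⟨le_rfl, u.coord_le⟩

theorem mem_minus_self (u : T.Point) : u.coord ∈ T.minus u u.edge := by
  rw [minus_self]
  exact ⟨u.coord_nonneg, le_rfl⟩

theorem exists_isPsiPlus (hz : 0 < z.im) (hT : T.NoInflow z) (hR : T.IsWeyl z R) {u : T.Point}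
    (hu : u.coord < T.length u.edge) :
    ∃ ψ, T.IsPsiPlus z u ψ ∧ ∀ φ, T.IsSolutionPlus z u φ →
      ∃ c : ℂ, ∀ e, ∀ s ∈ T.plus u e, φ e s = c * ψ e s := by
  have hne : weylValue T z R u.edge * sol z 1 (R u.edge) u.coord ≠ 0 :=
    mul_ne_zero (hR.weylValue_ne_zero hz _) (hR.sol_ne_zero hz hu.le)
  set N := weylValue T z R u.edge * sol z 1 (R u.edge) u.coord
  have hsol : ∀ e t, sol z (N⁻¹ * weylValue T z R e) (N⁻¹ * (weylValue T z R e * R e)) t =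
      N⁻¹ * (weylValue T z R e * sol z 1 (R e) t) := fun e t => by
    rw [sol_smul, ← sol_smul, ← sol_smul, mul_one, ← sol_smul]
  have hf : T.IsForward z u.edge (fun e => N⁻¹ * weylValue T z R e)
      (fun e => N⁻¹ * (weylValue T z R e * R e)) := by
    have h0 : T.IsForward z u.edge (fun _ => 0) (fun _ => 0) :=
      ⟨by simp [sol], by simp [dsol], by simp [energy, sol, summable_zero]⟩
    simpa using h0.sub_smul (ne_zero_of_im_pos hz) (hR.isForward hz u.edge) (-N⁻¹)
  refine ⟨_, ⟨hf.isSolutionPlus (ne_zero_of_im_pos hz) hu, ?_⟩, fun φ hφ => ?_⟩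
  · simp only [hsol]
    exact inv_mul_cancel₀ hne
  · obtain ⟨c, hc⟩ := hφ.exists_smul hz hT hR hu
    refine ⟨c * N, fun e s hs => ?_⟩
    simp only [(hc e s hs).1, hsol]
    field_simp

theorem IsSolutionMinus.const_mul {u : T.Point} {ψ : TreeEdge K → ℝ → ℂ}
    (hu : 0 < u.coord) (h : T.IsSolutionMinus α z u ψ) (c : ℂ) :
    T.IsSolutionMinus α z u fun e s => c * ψ e s := by
  have hd : ∀ e, ∀ s ∈ T.minus u e, edgeDeriv (T.minus u) (fun e s => c * ψ e s) e s =
      c * edgeDeriv (T.minus u) ψ e s := fun e s hs =>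
    derivWithin_const_mul c (h.isH2On.differentiableOn e s hs)
  have h0 : (0 : ℝ) ∈ T.minus u [] := by
    by_cases h : u.edge = []
    · rw [← h, minus_self]
      exact ⟨le_rfl, hu.le⟩
    · rw [minus_of_not_suffix fun h' => h (List.suffix_nil.1 h')]
      exact ⟨le_rfl, (T.length_pos _).le⟩
  refine ⟨⟨fun e => (h.isL2On.1 e).const_mul c, ?_⟩, ?_, fun e he he' => ⟨fun k => ?_, ?_⟩, ?_⟩
  · simp only [norm_mul, mul_pow, integral_const_mul]
    exact h.isL2On.2.mul_left _
  · have h1 := h.isH2On.const_mul c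
    have h2 : (fun e s => c * -(z * ψ e s)) = fun e s => -(z * (c * ψ e s)) := by
      funext e s
      ring
    rwa [h2] at h1
  · rw [(h.kirchhoff e he he').1 k]
  · rw [hd _ _ he, (h.kirchhoff e he he').2, Finset.mul_sum]
    exact Finset.sum_congr rfl fun k _ => (hd _ _ (he' k)).symm
  · have h1 := h.rootCondition
    rw [RootCondition] at h1 ⊢
    rw [hd _ _ h0]
    linear_combination c * h1

theorem exists_isPsiMinus (hK : 1 ≤ K) (hz : 0 < z.im) (hT : T.NoInflow z) (hR : T.IsWeyl z R)
    (hα : α ∈ Ico 0 Real.pi) {u : T.Point} (hu : 0 < u.coord) :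
    ∃ ψ, T.IsPsiMinus α z u ψ ∧ ∀ φ, T.IsSolutionMinus α z u φ →
      ∃ c : ℂ, ∀ e, ∀ s ∈ T.minus u e, φ e s = c * ψ e s := by
  have hne : sol z (minusData T α z R u.edge u.edge).1 (minusData T α z R u.edge u.edge).2
      u.coord ≠ 0 := by
    rw [minusData_of_suffix (List.suffix_refl _)]
    exact sol_pathData_ne_zero hz hR hα hu.le fun h => hu.ne' h.2.1
  refine ⟨_, ⟨(isSolutionMinus_minusData hz hR hK hu).const_mul hu (_)⁻¹, inv_mul_cancel₀ hne⟩,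
    fun φ hφ => ?_⟩
  obtain ⟨c, hc⟩ := hφ.exists_smul hz hR hT hu
  refine ⟨c * sol z (minusData T α z R u.edge u.edge).1 (minusData T α z R u.edge u.edge).2
      u.coord, fun e s hs => ?_⟩
  rw [(hc e s hs).1]
  field_simp

end

end MetricTree

theorem corollary2p2 {K : ℕ} (hK : 1 ≤ K) (T : MetricTree K)
    (α : ℝ) (hα : α ∈ Set.Ico 0 Real.pi)
    (hT : (∃ Lmin : ℝ, 0 < Lmin ∧ ∀ e, Lmin ≤ T.length e) ∨ IsSelfAdjoint (T.laplacian α))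
    (z : ℂ) (hz : 0 < z.im) :
    -- `ψ⁺(· ; z | u)` exists and is, up to a factor, the only square-integrable solution on `T⁺_u`
    (∀ u : T.Point, u.coord < T.length u.edge →
      ∃ ψ, T.IsPsiPlus z u ψ ∧
        ∀ φ, T.IsSolutionPlus z u φ →
          ∃ c : ℂ, ∀ e, ∀ s ∈ T.plus u e, φ e s = c * ψ e s) ∧
    -- `ψ⁻(· ; z | u)` exists and is, up to a factor, the only square-integrable solution on `T⁻_u`
    (∀ u : T.Point, 0 < u.coord →
      ∃ ψ, T.IsPsiMinus α z u ψ ∧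
        ∀ φ, T.IsSolutionMinus α z u φ →
          ∃ c : ℂ, ∀ e, ∀ s ∈ T.minus u e, φ e s = c * ψ e s) ∧
    -- the ratios depend on the point `x` only, not on the cut `u`
    ∃ Rplus Rminus : T.Point → ℂ,
      (∀ u x : T.Point, u.coord < T.length u.edge → x.coord ∈ T.plus u x.edge →
        ∀ ψ, T.IsPsiPlus z u ψ →
          ψ x.edge x.coord ≠ 0 ∧
          1 / ψ x.edge x.coord * MetricTree.edgeDeriv (T.plus u) ψ x.edge x.coord = Rplus x) ∧
      (∀ u x : T.Point, 0 < u.coord → x.coord ∈ T.minus u x.edge → u.coord ∈ T.plus x u.edge →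
        -- at the root under the Dirichlet condition the ratio is infinite
        ¬ (x.edge = [] ∧ x.coord = 0 ∧ α = 0) →
        ∀ ψ, T.IsPsiMinus α z u ψ →
          ψ x.edge x.coord ≠ 0 ∧
          -(1 / ψ x.edge x.coord * MetricTree.edgeDeriv (T.minus u) ψ x.edge x.coord)
            = Rminus x) ∧
      -- the cuts `u` on other branches than `x` also give one common value, namely `-Rplus x`
      (∀ u x : T.Point, 0 < u.coord → x.coord ∈ T.minus u x.edge → u.coord ∉ T.plus x u.edge →
        ∀ ψ, T.IsPsiMinus α z u ψ →
          ψ x.edge x.coord ≠ 0 ∧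
          -(1 / ψ x.edge x.coord * MetricTree.edgeDeriv (T.minus u) ψ x.edge x.coord)
            = -Rplus x) := by
  have hN : T.NoInflow z := by
    rcases hT with ⟨ℓ, hℓ, hL⟩ | hA
    · exact MetricTree.noInflow_of_le_length hz hℓ hL
    · exact MetricTree.noInflow_of_isSelfAdjoint hz hA
  obtain ⟨R, hR⟩ := T.exists_isWeyl hz
  have ratio : ∀ c a b : ℂ, c ≠ 0 → 1 / (c * a) * (c * b) = 1 / a * b := fun c a b hc => by
    rw [one_div_mul_eq_div, one_div_mul_eq_div, mul_div_mul_left _ _ hc]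
  refine ⟨fun u hu => MetricTree.exists_isPsiPlus hz hN hR hu,
    fun u hu => MetricTree.exists_isPsiMinus hK hz hN hR hα hu,
    fun x => 1 / MetricTree.sol z 1 (R x.edge) x.coord * MetricTree.dsol z 1 (R x.edge) x.coord,
    fun x => -(1 / MetricTree.sol z (MetricTree.pathData T α z R x.edge).1
        (MetricTree.pathData T α z R x.edge).2 x.coord *
      MetricTree.dsol z (MetricTree.pathData T α z R x.edge).1
        (MetricTree.pathData T α z R x.edge).2 x.coord), ?_, ?_, ?_⟩
  · rintro u x hu hx ψ ⟨hψ, hψu⟩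
    obtain ⟨c, hc⟩ := hψ.exists_smul hz hN hR hu
    have hc0 : c ≠ 0 := fun h => by
      rw [(hc _ _ (MetricTree.mem_plus_self u)).1, h] at hψu
      simp at hψu
    have hcw := mul_ne_zero hc0 (hR.weylValue_ne_zero hz x.edge)
    rw [(hc _ _ hx).1, (hc _ _ hx).2]
    exact ⟨mul_ne_zero hcw (hR.sol_ne_zero hz x.coord_le), ratio _ _ _ hcw⟩
  · rintro u x hu hx hux hroot ψ ⟨hψ, hψu⟩
    obtain ⟨c, hc⟩ := hψ.exists_smul hz hR hN hu
    have hc0 : c ≠ 0 := fun h => by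
      rw [(hc _ _ (MetricTree.mem_minus_self u)).1, h] at hψu
      simp at hψu
    rw [(hc _ _ hx).1, (hc _ _ hx).2,
      MetricTree.minusData_of_suffix (MetricTree.suffix_of_mem_plus hux), ratio _ _ _ hc0]
    exact ⟨mul_ne_zero hc0 (MetricTree.sol_pathData_ne_zero hz hR hα x.coord_nonneg hroot), rfl⟩
  · rintro u x hu hx hux ψ ⟨hψ, hψu⟩
    obtain ⟨c, hc⟩ := hψ.exists_smul hz hR hN hu
    have hc0 : c ≠ 0 := fun h => by
      rw [(hc _ _ (MetricTree.mem_minus_self u)).1, h] at hψu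
      simp at hψu
    have hs := MetricTree.not_suffix_of_notMem_plus hx hux
    have hne := mul_ne_zero hc0 (MetricTree.minusData_ne_zero (T := T) hz hR hα hs)
    rw [(hc _ _ hx).1, (hc _ _ hx).2, (MetricTree.sol_minusData_of_not_suffix hs _).1,
      (MetricTree.sol_minusData_of_not_suffix hs _).2, ← mul_assoc c _ (MetricTree.sol _ _ _ _),
      ← mul_assoc c _ (MetricTree.dsol _ _ _ _), ratio _ _ _ hne]
    exact ⟨mul_ne_zero hne (hR.sol_ne_zero hz x.coord_le), rfl⟩
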